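/- **Completeness of the measurement protocol.** Notation: $\mathrm{Supp}$ is the support of a density, $H^2(p,q)=1-\sum_y\sqrt{p(y)q(y)}$, $\mathrm{TV}(p,q)=\frac12\sum_y|p(y)-q(y)|$, $\oplus$ and $d\cdot z$ are addition and inner product modulo $2$; a function $\mu:\mathbb N\to\mathbb R_{\ge0}$ is negligible if $p(\lambda)\mu(\lambda)\to0$ for every polynomial $p$. All sets and procedures below depend on the security parameter $\lambda$. *Families.* Let $\mathcal X,\mathcal Y$ be finite sets and $w$ a polynomially bounded function of $\lambda$. Let $\mathcal F,\mathcal G$ be families of densities $f_{k,b}(x)$, $g_{k,b}(x)$ on $\mathcal Y$ ($b\in\{0,1\}$, $x\in\mathcal X$), with randomized procedures $\mathrm{GEN}_{\mathcal F},\mathrm{GEN}_{\mathcal G}$ that output a key $k$ and a trapdoor $t$, such that the following holds for all $(k,t)$ that they output with positive probability. - For $(k,t)$ from $\mathrm{GEN}_{\mathcal F}$: (i) $f_{k,b}(x)$ and $f_{k,b}(x')$ have disjoint supports if $x\ne x'$, and $\mathrm{INV}_{\mathcal F}(t,b,y)=x$ for $y\in\mathrm{Supp}(f_{k,b}(x))$;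 (ii) there is a perfect matching $\mathcal R_k\subseteq\mathcal X\times\mathcal X$ with $f_{k,0}(x_0)=f_{k,1}(x_1)$ if and only if $(x_0,x_1)\in\mathcal R_k$; (iii) there are densities $f'_{k,b}(x)$ on $\mathcal Y$ such that for $(x_0,x_1)\in\mathcal R_k$ and $y\in\mathrm{Supp}(f'_{k,b}(x_b))$ both $\mathrm{INV}_{\mathcal F}(t,0,y)=x_0$ and $\mathrm{INV}_{\mathcal F}(t,1,y)=x_1$, and the average of $H^2(f_{k,b}(x),f'_{k,b}(x))$ over uniform $x\in\mathcal X$ is at most a negligible function of $\lambda$ (the same for all $k,b$); (iv) there are sets $G_{k,b,x}\subseteq\{0,1\}^w$ such that a uniform $d\in\{0,1\}^w$ lies outside $G_{k,b,x}$ with at most negligible probability (one bound for all $k,b,x$). There is also an injection $J:\mathcal X\to\{0,1\}^w$. - For $(k,t)$ from $\mathrm{GEN}_{\mathcal G}$: the supports of the $g_{k,b}(x)$, for different pairs $(b,x)$, are disjoint, and $\mathrm{INV}_{\mathcal G}(t,y)=(b,x)$ for $y\in\mathrm{Supp}(g_{k,b}(x))$. - There is one procedure $\mathrm{CHK}$ and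 one procedure $\mathrm{SAMP}$ for both families. With $\varphi=f'$ for keys from $\mathrm{GEN}_{\mathcal F}$ and $\varphi=g$ for keys from $\mathrm{GEN}_{\mathcal G}$: $\mathrm{CHK}(k,b,x,y)=1$ if and only if $y\in\mathrm{Supp}(\varphi_{k,b}(x))$, and $\mathrm{SAMP}(k,b)$ prepares $|\mathcal X|^{-1/2}\sum_{x,y}\sqrt{\varphi_{k,b}(x)(y)}\,|x\rangle|y\rangle$. Every extended trapdoor claw-free family with its trapdoor injective family is of this kind; the further, computational requirements on such families (efficiency, hardness) are not needed. *Protocol for $h\in\{0,1\}^n$*, where $n$ is polynomially bounded in $\lambda$. For each $i$ the verifier independently draws $(k_i,t_i)$ from $\mathrm{GEN}_{\mathcal G}$ if $h_i=0$ and from $\mathrm{GEN}_{\mathcal F}$ if $h_i=1$, sends $k_1,\dots,k_n$ and receives $y_1,\dots,y_n\in\mathcal Y$. *Test round:* the verifier receives $(b'_i,x'_i)_i$ and accepts if and only if $\mathrm{CHK}(k_i,b'_i,x'_i,y_i)=1$ for all $i$. *Hadamard round:* the verifier receives $(b'_i,d_i)_i$ with $d_i\in\{0,1\}^w$. If $h_i=0$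 he stores the first component $m_i$ of $\mathrm{INV}_{\mathcal G}(t_i,y_i)$. If $h_i=1$ he computes $x_{b}=\mathrm{INV}_{\mathcal F}(t_i,b,y_i)$ for $b=0,1$, checks that $d_i\in G_{k_i,0,x_0}\cap G_{k_i,1,x_1}$ and stores $m_i=b'_i\oplus d_i\cdot(J(x_0)\oplus J(x_1))$. If an inverse does not exist or a check fails, he stores a random bit and rejects. *Honest prover for an $n$-qubit state $\rho$.* Given the keys, he applies $|b\rangle\mapsto|b\rangle\,\mathrm{SAMP}(k_i,b)$ to the $i$-th qubit of $\rho$ for every $i$, measures the registers containing $y_i$ and sends the results. In a test round he measures the qubits and the registers containing $x_i$ in the standard basis and sends the results. In a Hadamard round he first applies $|x\rangle\mapsto|J(x)\rangle$ to each of these registers, then measures the qubits and these registers in the Hadamard basis and sends the results. **Claim.** For all $\lambda$, all $n$-qubit states $\rho$ and all $h\in\{0,1\}^n$, the honest prover for $\rho$ is accepted in the test round with probability exactly $1$. Moreover there is a negligible function $\mu$, which depends only on the families and on the function $n$, such that for all $\lambda$, all $n$-qubit states $\rho$ and all $h\in\{0,1\}^n$ he is accepted in the Hadamard round with probability at least $1-\mu(\lambda)$,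 and, whenever this acceptance probability is positive, the distribution of $(m_1,\dots,m_n)$ in the Hadamard round conditioned on acceptance is within total variation distance $\mu(\lambda)$ of $D_{\rho,h}$, the distribution of the results of measuring the $i$-th qubit of $\rho$ in the standard basis if $h_i=0$ and in the Hadamard basis if $h_i=1$. -/

import Mathlib

namespace MeasurementProtocol

open scoped ENNReal Matrix Kronecker ComplexOrder

noncomputable section

/-! ### Asymptotics -/

/-- A nonnegative function of the security parameter is negligible if its product with every
polynomial tends to zero. -/
def Negligible (μ : ℕ → ℝ) : Prop :=
  (∀ l, 0 ≤ μ l) ∧ Asymptotics.SuperpolynomialDecay Filter.atTop (fun l : ℕ => (l : ℝ)) μ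

def PolyBounded (n : ℕ → ℕ) : Prop :=
  ∃ p : Polynomial ℝ, ∀ l : ℕ, (n l : ℝ) ≤ p.eval (l : ℝ)

/-! ### Bits and finite probability -/

/-- Bits are elements of the field with two elements: `⊕` is `+`, and the inner product of two bit
strings is the dot product `⬝ᵥ`. -/
abbrev Bit : Type := ZMod 2

/-- Bit strings of length `w`. -/
abbrev Bits (w : ℕ) : Type := Fin w → Bit

/-- Squared Hellinger distance of two densities on a finite set. -/
def hellingerSq {α : Type} [Fintype α] (p q : PMF α) : ℝ :=
  1 - ∑ a, Real.sqrt ((p a).toReal * (q a).toReal)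

/-- Total variation distance of two densities on a finite set. -/
def tvDist {α : Type} [Fintype α] (p q : PMF α) : ℝ :=
  1 / 2 * ∑ a, |(p a).toReal - (q a).toReal|

/-- The joint distribution of `n` independent draws, the `i`-th one from `p i`. -/
def independent {α : Type} : {n : ℕ} → (Fin n → PMF α) → PMF (Fin n → α)
  | 0, _ => PMF.pure Fin.elim0
  | _ + 1, p => (p 0).bind fun a => (independent fun i => p i.succ).bind fun v =>
      PMF.pure (Fin.cons a v)

/-! ### Quantum states -/

/-- A pure state on a register with standard basis indexed by `ι`. -/
structure PureState (ι : Type) [Fintype ι] where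
  vec : ι → ℂ
  norm_one : ∑ i, ‖vec i‖ ^ 2 = 1

/-- A density matrix on a register with standard basis indexed by `ι`. -/
structure QState (ι : Type) [Fintype ι] where
  mat : Matrix ι ι ℂ
  posSemidef : mat.PosSemidef
  trace_one : mat.trace = 1

/-- An isometry from a register with basis `ι` to one with basis `κ`: a unitary operation that may
use auxiliary registers initialised to `0`. -/
structure LIso (ι κ : Type) [Fintype ι] [Fintype κ] [DecidableEq ι] where
  mat : Matrix κ ι ℂ
  isometry : matᴴ * mat = 1

/-- The identity operation. -/
def LIso.id (ι : Type) [Fintype ι] [DecidableEq ι] : LIso ι ι where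
  mat := 1
  isometry := by simp

/-- Tensor product of two operations. -/
def LIso.prod {ι κ ι₂ κ₂ : Type} [Fintype ι] [DecidableEq ι] [Fintype κ] [Fintype ι₂]
    [DecidableEq ι₂] [Fintype κ₂] (A : LIso ι κ) (B : LIso ι₂ κ₂) : LIso (ι × ι₂) (κ × κ₂) where
  mat := A.mat ⊗ₖ B.mat
  isometry := by
    rw [Matrix.conjTranspose_kronecker, ← Matrix.mul_kronecker_mul, A.isometry, B.isometry,
      Matrix.one_kronecker_one]

/-- Tensor product of `n` operations. -/
def LIso.tensor {ι κ : Type} [Fintype ι] [DecidableEq ι] [Fintype κ] {n : ℕ}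
    (A : Fin n → LIso ι κ) : LIso (Fin n → ι) (Fin n → κ) where
  mat := Matrix.of fun a b => ∏ i, (A i).mat (a i) (b i)
  isometry := by
    classical
    ext b c
    have h : ∀ i, ∑ a, star ((A i).mat a (b i)) * (A i).mat a (c i)
        = (1 : Matrix ι ι ℂ) (b i) (c i) := by
      intro i
      rw [← (A i).isometry]
      simp [Matrix.mul_apply, Matrix.conjTranspose_apply]
    simp only [Matrix.mul_apply, Matrix.conjTranspose_apply, Matrix.of_apply, star_prod, ← Finset.prod_mul_distrib]
    rw [← Fintype.prod_sum fun i a => star ((A i).mat a (b i)) * (A i).mat a (c i)]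
    simp only [h, Matrix.one_apply]
    by_cases hbc : b = c
    · simp [hbc]
    · obtain ⟨i, hi⟩ := Function.ne_iff.mp hbc
      rw [if_neg hbc]
      exact Finset.prod_eq_zero (Finset.mem_univ i) (if_neg hi)

/-- The result `V ρ V†` of applying the operation `V` to the state `ρ`. -/
def QState.apply {ι κ : Type} [Fintype ι] [DecidableEq ι] [Fintype κ] (ρ : QState ι) (V : LIso ι κ) : QState κ where
  mat := V.mat * ρ.mat * V.matᴴ
  posSemidef := ρ.posSemidef.mul_mul_conjTranspose_same _
  trace_one := by
    rw [Matrix.trace_mul_comm, ← Matrix.mul_assoc, V.isometry, Matrix.one_mul, ρ.trace_one]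

/-- Relabelling of the basis. -/
def QState.reindex {ι κ : Type} [Fintype ι] [Fintype κ] (ρ : QState ι) (e : ι ≃ κ) : QState κ where
  mat := ρ.mat.submatrix e.symm e.symm
  posSemidef := ρ.posSemidef.submatrix _
  trace_one := by
    rw [← ρ.trace_one]
    exact Equiv.sum_comp e.symm fun i => ρ.mat i i


/-- Outcome distribution of a standard basis measurement of the whole register. -/
def QState.measure {ι : Type} [Fintype ι] (ρ : QState ι) : PMF ι :=
  PMF.ofFintype (fun i => ENNReal.ofReal (ρ.mat i i).re) (by
    rw [← ENNReal.ofReal_sum_of_nonneg fun i _ =>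
      (Complex.le_def.mp ρ.posSemidef.diag_nonneg).1]
    have h := congrArg Complex.re ρ.trace_one
    simp only [Matrix.trace, Matrix.diag_apply, Complex.re_sum, Complex.one_re] at h
    rw [h, ENNReal.ofReal_one])

/-- The unnormalised state `(1 ⊗ ⟨c|) ρ (1 ⊗ |c⟩)` left in the first register when a standard basis
measurement of the second one gives `c`. -/
def QState.branch {S C : Type} [Fintype S] [Fintype C] (ρ : QState (S × C)) (c : C) : Matrix S S ℂ :=
  ρ.mat.submatrix (fun s => (s, c)) (fun s => (s, c))

theorem QState.branch_posSemidef {S C : Type} [Fintype S] [Fintype C] (ρ : QState (S × C)) (c : C) : (ρ.branch c).PosSemidef :=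
  ρ.posSemidef.submatrix _

/-- Outcome distribution of a standard basis measurement of the second register. -/
def QState.measureSnd {S C : Type} [Fintype S] [Fintype C] (ρ : QState (S × C)) : PMF C :=
  PMF.ofFintype (fun c => ENNReal.ofReal (ρ.branch c).trace.re) (by
    rw [← ENNReal.ofReal_sum_of_nonneg fun c _ =>
      (Complex.le_def.mp (ρ.branch_posSemidef c).trace_nonneg).1]
    have h := congrArg Complex.re ρ.trace_one
    simp only [Matrix.trace, Matrix.diag_apply, Complex.re_sum, Complex.one_re,
      Fintype.sum_prod_type] at h
    rw [Finset.sum_comm] at h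
    simp only [Matrix.trace, Matrix.diag_apply, Complex.re_sum, QState.branch,
      Matrix.submatrix_apply]
    rw [h, ENNReal.ofReal_one])

/-- The normalised state left in the first register when a standard basis measurement of the second
one gives `c`, an outcome of positive probability. -/
def QState.post {S C : Type} [Fintype S] [Fintype C] (ρ : QState (S × C)) (c : C) (hc : c ∈ ρ.measureSnd.support) : QState S where
  mat := ((ρ.branch c).trace.re⁻¹ : ℝ) • ρ.branch c
  posSemidef := (ρ.branch_posSemidef c).smul
    (inv_nonneg.mpr (Complex.le_def.mp (ρ.branch_posSemidef c).trace_nonneg).1)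
  trace_one := by
    have h0 : 0 < (ρ.branch c).trace.re := by
      have := (PMF.mem_support_iff _ _).mp hc
      simpa [QState.measureSnd] using this
    have h1 := Complex.le_def.mp (ρ.branch_posSemidef c).trace_nonneg
    rw [Matrix.trace_smul]
    apply Complex.ext
    · simp [h0.ne']
    · simp [← h1.2]

/-- Standard basis measurement of the second register: the outcome together with the state then left
in the first register. -/
def QState.partialMeasure {S C : Type} [Fintype S] [Fintype C] (ρ : QState (S × C)) : PMF (C × QState S) :=
  ρ.measureSnd.bindOnSupport fun c hc => PMF.pure (c, ρ.post c hc)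

/-- The Hadamard gate. -/
def hadamard : LIso Bit Bit where
  mat := Matrix.of fun a b => if a = 1 ∧ b = 1 then -((Real.sqrt 2)⁻¹ : ℝ) else ((Real.sqrt 2)⁻¹ : ℝ)
  isometry := by
    have h : (((Real.sqrt 2)⁻¹ : ℝ) : ℂ) * (((Real.sqrt 2)⁻¹ : ℝ) : ℂ) = 1 / 2 := by
      rw [← Complex.ofReal_mul, ← mul_inv, Real.mul_self_sqrt (by norm_num)]; norm_num
    have e : (Finset.univ : Finset Bit) = {0, 1} := by decide
    have z : ∀ a : Bit, a = 0 ∨ a = 1 := by decide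
    ext i j
    simp only [Matrix.mul_apply, Matrix.conjTranspose_apply, Matrix.of_apply, e]
    rw [Finset.sum_pair (by decide)]
    rcases z i with rfl | rfl <;> rcases z j with rfl | rfl <;>
      simp [-Complex.ofReal_inv, h] <;> norm_num

/-- The distribution of the results of measuring the `i`-th qubit of `ρ` in the standard basis if
`h i = 0` and in the Hadamard basis if `h i = 1`. -/
def basisMeasure {n : ℕ} (ρ : QState (Bits n)) (h : Bits n) : PMF (Bits n) :=
  (ρ.apply (LIso.tensor fun i => if h i = 0 then LIso.id Bit else hadamard)).measure

/-! ### Function families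

The families are indexed by the security parameter `l`; `X l` is the domain, `Y l` the range,
`K l` the set of strings that may serve as keys and `T l` the set of trapdoors. Keys that are never
generated play no role, so "every key" is read as "every pair of a key and a trapdoor that the key
generation outputs with positive probability".

Only the statistical requirements on the families are imposed. The computational ones (running times
of the procedures, the adaptive hardcore bit inequalities, indistinguishability of the two kinds of
keys) would be further restrictions on the families, so every family with those properties is
covered. -/

/-- Noisy trapdoor claw-free family (statistical requirements). -/
structure NTCF (X Y K T : ℕ → Type) [∀ l, Fintype (X l)] [∀ l, Fintype (Y l)] (w : ℕ → ℕ) where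
  /-- Generation of a key together with a trapdoor. -/
  gen : ∀ l, PMF (K l × T l)
  /-- The functions `f_{k,b}`, with values in the densities on `Y`. -/
  f : ∀ l, K l → Bit → X l → PMF (Y l)
  /-- Inversion with the trapdoor; `none` means that the inverse does not exist. -/
  inv : ∀ l, T l → Bit → Y l → Option (X l)
  supp_disjoint : ∀ l, ∀ kt ∈ (gen l).support, ∀ b x x', x ≠ x' →
    Disjoint (f l kt.1 b x).support (f l kt.1 b x').support
  inv_eq : ∀ l, ∀ kt ∈ (gen l).support, ∀ b x, ∀ y ∈ (f l kt.1 b x).support,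
    inv l kt.2 b y = some x
  /-- The perfect matching, as the bijection `x₀ ↦ x₁` whose graph it is. -/
  matching : ∀ l, K l → X l ≃ X l
  injective_pair : ∀ l, ∀ kt ∈ (gen l).support, ∀ x₀ x₁,
    f l kt.1 0 x₀ = f l kt.1 1 x₁ ↔ matching l kt.1 x₀ = x₁
  /-- The functions `f'_{k,b}`, used in place of `f_{k,b}` for range superpositions. -/
  fApprox : ∀ l, K l → Bit → X l → PMF (Y l)
  inv_approx_zero : ∀ l, ∀ kt ∈ (gen l).support, ∀ x₀ x₁, matching l kt.1 x₀ = x₁ →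
    ∀ y ∈ (fApprox l kt.1 0 x₀).support, inv l kt.2 0 y = some x₀ ∧ inv l kt.2 1 y = some x₁
  inv_approx_one : ∀ l, ∀ kt ∈ (gen l).support, ∀ x₀ x₁, matching l kt.1 x₀ = x₁ →
    ∀ y ∈ (fApprox l kt.1 1 x₁).support, inv l kt.2 1 y = some x₁ ∧ inv l kt.2 0 y = some x₀
  /-- The checking procedure, which gets no trapdoor. -/
  chk : ∀ l, K l → Bit → X l → Y l → Bool
  chk_iff : ∀ l, ∀ kt ∈ (gen l).support, ∀ b x y,
    chk l kt.1 b x y = true ↔ y ∈ (fApprox l kt.1 b x).support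
  hellinger_negligible : ∃ μ, Negligible μ ∧ ∀ l, ∀ kt ∈ (gen l).support, ∀ b,
    (∑ x, hellingerSq (f l kt.1 b x) (fApprox l kt.1 b x)) / Fintype.card (X l) ≤ μ l
  /-- The state preparation procedure. -/
  samp : ∀ l, K l → Bit → PureState (X l × Y l)
  samp_eq : ∀ l, ∀ kt ∈ (gen l).support, ∀ b x y, (samp l kt.1 b).vec (x, y) =
    (1 / Real.sqrt (Fintype.card (X l)) * Real.sqrt (fApprox l kt.1 b x y).toReal : ℝ)
  w_poly : PolyBounded w
  /-- The sets `G_{k,b,x}`. -/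
  G : ∀ l, K l → Bit → X l → Set (Bits (w l))
  G_negligible : ∃ μ, Negligible μ ∧ ∀ l, ∀ kt ∈ (gen l).support, ∀ b x,
    ((G l kt.1 b x)ᶜ.ncard : ℝ) / 2 ^ w l ≤ μ l
  /-- The injection of the domain into the bit strings. -/
  J : ∀ l, X l ↪ Bits (w l)

/-- Trapdoor injective family (statistical requirements). -/
structure TrapdoorInjective (X Y K T : ℕ → Type) [∀ l, Fintype (X l)] [∀ l, Fintype (Y l)] where
  gen : ∀ l, PMF (K l × T l)
  /-- The functions `g_{k,b}`, with values in the densities on `Y`. -/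
  g : ∀ l, K l → Bit → X l → PMF (Y l)
  supp_disjoint : ∀ l, ∀ kt ∈ (gen l).support, ∀ b b' x x', (b, x) ≠ (b', x') →
    Disjoint (g l kt.1 b x).support (g l kt.1 b' x').support
  inv : ∀ l, T l → Y l → Option (Bit × X l)
  inv_eq : ∀ l, ∀ kt ∈ (gen l).support, ∀ b x, ∀ y ∈ (g l kt.1 b x).support,
    inv l kt.2 y = some (b, x)
  chk : ∀ l, K l → Bit → X l → Y l → Bool
  chk_iff : ∀ l, ∀ kt ∈ (gen l).support, ∀ b x y,
    chk l kt.1 b x y = true ↔ y ∈ (g l kt.1 b x).support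
  samp : ∀ l, K l → Bit → PureState (X l × Y l)
  samp_eq : ∀ l, ∀ kt ∈ (gen l).support, ∀ b x y, (samp l kt.1 b).vec (x, y) =
    (1 / Real.sqrt (Fintype.card (X l)) * Real.sqrt (g l kt.1 b x y).toReal : ℝ)

/-- Extended trapdoor claw-free family together with its trapdoor injective family (statistical
requirements): the checking and the state preparation procedures of the two are the same. -/
structure ExtendedTCF (X Y K T : ℕ → Type) [∀ l, Fintype (X l)] [∀ l, Fintype (Y l)]
    (w : ℕ → ℕ) where
  F : NTCF X Y K T w
  I : TrapdoorInjective X Y K T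
  chk_same : F.chk = I.chk
  samp_same : F.samp = I.samp

/-! ### The measurement protocol -/

/-- A prover for `n` qubits: on the function choice it sends commitment strings and keeps an internal
state, from which it later answers either the request of a test round (bits and preimages) or that of
a Hadamard round (bits and strings in `{0,1}^w`). -/
structure Prover (X Y K : Type) (w n : ℕ) where
  Mem : Type
  commit : (Fin n → K) → PMF ((Fin n → Y) × Mem)
  testAnswer : Mem → PMF (Fin n → Bit × X)
  hadamardAnswer : Mem → PMF (Fin n → Bit × Bits w)

section Verifier

variable {X Y K T : ℕ → Type} [∀ l, Fintype (X l)] [∀ l, Fintype (Y l)] {w : ℕ → ℕ}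

/-- The keys and trapdoors chosen by the verifier for the basis choice `h`. -/
def verifierKeys (E : ExtendedTCF X Y K T w) (l : ℕ) {n : ℕ} (h : Bits n) :
    PMF (Fin n → K l × T l) :=
  independent fun i => if h i = 0 then E.I.gen l else E.F.gen l

/-- The check of one test round answer. -/
def testCheck (E : ExtendedTCF X Y K T w) (l : ℕ) (hi : Bit) (k : K l) (y : Y l)
    (a : Bit × X l) : Bool :=
  if hi = 0 then E.I.chk l k a.1 a.2 y else E.F.chk l k a.1 a.2 y

/-- A test round against the prover `P`; the value tells whether the verifier accepts. -/
def testRound (E : ExtendedTCF X Y K T w) (l : ℕ) {n : ℕ} (P : Prover (X l) (Y l) (K l) (w l) n)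
    (h : Bits n) : PMF Bool :=
  (verifierKeys E l h).bind fun kt =>
    (P.commit fun i => (kt i).1).bind fun ys =>
      (P.testAnswer ys.2).bind fun a =>
        PMF.pure (decide (∀ i, testCheck E l (h i) (kt i).1 (ys.1 i) (a i) = true))

/-- The verifier's treatment of one qubit in a Hadamard round: a flag that tells whether this qubit
passes, and the stored measurement result (a random bit if it does not pass). -/
def decode (E : ExtendedTCF X Y K T w) (l : ℕ) (hi : Bit) (k : K l) (t : T l) (y : Y l)
    (a : Bit × Bits (w l)) : PMF (Bool × Bit) :=
  let reject : PMF (Bool × Bit) := (PMF.uniformOfFintype Bit).map fun r => (false, r)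
  if hi = 0 then
    match E.I.inv l t y with
    | some (m, _) => PMF.pure (true, m)
    | none => reject
  else
    match E.F.inv l t 0 y, E.F.inv l t 1 y with
    | some x₀, some x₁ =>
      open Classical in
      if a.2 ∈ E.F.G l k 0 x₀ ∩ E.F.G l k 1 x₁ then
        PMF.pure (true, a.1 + a.2 ⬝ᵥ (E.F.J l x₀ + E.F.J l x₁))
      else reject
    | _, _ => reject

/-- A Hadamard round against the prover `P`; the value consists of whether the verifier accepts and of
the string of stored measurement results. -/
def hadamardRound (E : ExtendedTCF X Y K T w) (l : ℕ) {n : ℕ}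
    (P : Prover (X l) (Y l) (K l) (w l) n) (h : Bits n) : PMF (Bool × Bits n) :=
  (verifierKeys E l h).bind fun kt =>
    (P.commit fun i => (kt i).1).bind fun ys =>
      (P.hadamardAnswer ys.2).bind fun a =>
        (independent fun i => decode E l (h i) (kt i).1 (kt i).2 (ys.1 i) (a i)).map fun v =>
          (decide (∀ i, (v i).1 = true), fun i => (v i).2)

/-- Probability of acceptance in a test round. -/
def testAccept (E : ExtendedTCF X Y K T w) (l : ℕ) {n : ℕ} (P : Prover (X l) (Y l) (K l) (w l) n)
    (h : Bits n) : ℝ :=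
  (testRound E l P h true).toReal

/-- Probability of acceptance in a Hadamard round. -/
def hadamardAccept (E : ExtendedTCF X Y K T w) (l : ℕ) {n : ℕ}
    (P : Prover (X l) (Y l) (K l) (w l) n) (h : Bits n) : ℝ :=
  ((hadamardRound E l P h).map Prod.fst true).toReal

/-- Acceptance in a Hadamard round has positive probability. -/
def HadamardPossible (E : ExtendedTCF X Y K T w) (l : ℕ) {n : ℕ}
    (P : Prover (X l) (Y l) (K l) (w l) n) (h : Bits n) : Prop :=
  ∃ v ∈ {v : Bool × Bits n | v.1 = true}, v ∈ (hadamardRound E l P h).support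

/-- The distribution of the stored results of a Hadamard round, conditioned on acceptance. -/
def conditionedResults (E : ExtendedTCF X Y K T w) (l : ℕ) {n : ℕ}
    (P : Prover (X l) (Y l) (K l) (w l) n) (h : Bits n) (hP : HadamardPossible E l P h) :
    PMF (Bits n) :=
  ((hadamardRound E l P h).filter {v | v.1 = true} hP).map Prod.snd

end Verifier

/-! ### The honest prover -/

section Honest

/-- Commitment to one qubit before the measurement: the state preparation `s`, controlled on the
qubit, i.e. `|b⟩ ↦ |b⟩ ⊗ s_b`. -/
def commitQubit {X Y : Type} [Fintype X] [Fintype Y] (s : Bit → PureState (X × Y)) :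
    LIso Bit ((Bit × X) × Y) where
  mat := Matrix.of fun r b => if r.1.1 = b then (s b).vec (r.1.2, r.2) else 0
  isometry := by
    classical
    have e : (Finset.univ : Finset Bit) = {0, 1} := by decide
    have z : ∀ a : Bit, a = 0 ∨ a = 1 := by decide
    have h : ∀ b, ∑ x, ∑ y, (starRingEnd ℂ) ((s b).vec (x, y)) * (s b).vec (x, y) = 1 := by
      intro b
      have h1 := congrArg (fun r : ℝ => (r : ℂ)) (s b).norm_one
      simp only [Complex.ofReal_sum, Complex.ofReal_pow, Complex.ofReal_one,
        ← Complex.conj_mul', Fintype.sum_prod_type] at h1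
      exact h1
    ext i j
    simp only [Matrix.mul_apply, Matrix.conjTranspose_apply, Matrix.of_apply,
      Fintype.sum_prod_type, e]
    rw [Finset.sum_pair (by decide)]
    rcases z i with rfl | rfl <;> rcases z j with rfl | rfl <;> simp [h]

/-- The unitary `U_J`: `|b⟩|x⟩ ↦ |b⟩|J(x)⟩`. -/
def applyJ {X : Type} [Fintype X] [DecidableEq X] {w : ℕ} (J : X ↪ Bits w) :
    LIso (Bit × X) (Bit × Bits w) where
  mat := Matrix.of fun r s => if r = (s.1, J s.2) then 1 else 0
  isometry := by
    ext p q
    simp only [Matrix.mul_apply, Matrix.conjTranspose_apply, Matrix.of_apply, Matrix.one_apply]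
    rw [Finset.sum_eq_single (p.1, J p.2) (fun r _ hr => by simp [hr]) (by simp)]
    simp [Prod.ext_iff]

/-- The state of the prover holding `ρ` after committing to every qubit and before measuring the
commitment registers. It is split into the pairs of a committed qubit and a preimage register on the
one hand, and the commitment registers on the other. -/
def committedState {X Y K : Type} [Fintype X] [Fintype Y] {n : ℕ}
    (samp : K → Bit → PureState (X × Y)) (ρ : QState (Bits n)) (k : Fin n → K) :
    QState ((Fin n → Bit × X) × (Fin n → Y)) :=
  (ρ.apply (LIso.tensor fun i => commitQubit (samp (k i)))).reindex
    (Equiv.arrowProdEquivProdArrow (Fin n) (fun _ => Bit × X) (fun _ => Y))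

/-- The honest prover for the state `ρ`. It does not know the basis choice. -/
def honestProver {X Y K : Type} [Fintype X] [DecidableEq X] [Fintype Y] {w n : ℕ}
    (samp : K → Bit → PureState (X × Y)) (J : X ↪ Bits w) (ρ : QState (Bits n)) :
    Prover X Y K w n where
  Mem := QState (Fin n → Bit × X)
  commit := fun k => (committedState samp ρ k).partialMeasure
  testAnswer := fun σ => σ.measure
  hadamardAnswer := fun σ =>
    ((σ.apply (LIso.tensor fun _ => applyJ J)).apply
      (LIso.tensor fun _ => hadamard.prod (LIso.tensor fun _ => hadamard))).measure

end Honest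

end

end MeasurementProtocol

open MeasurementProtocol

namespace MeasurementProtocol

open scoped ENNReal Matrix Kronecker ComplexOrder

noncomputable section

/-! Fix the keys. The probability of acceptance with results `m` is the expectation in `ρ` of a
tensor product of single-qubit effects. The effect of qubit `i` is the sum, over its commitment
string and answer, of the rank-one effects of the amplitudes `answerAmp`, weighted by the
probability that `decode` passes and stores `m i`. So it suffices to compute one 2×2 matrix.

For an injective key, `y` reveals the control bit, and the effect is exactly `|m⟩⟨m|`
(`sum_decode_zero`). For a claw-free key, `y` singles out one claw `(x₀, x₁)`. After the Hadamard
gates its two branches have relative sign `(-1)^(b' + d·(J x₀ + J x₁))`, which is `(-1)^m` whenever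
the verifier stores `m`. Hence the diagonal entries are half of `passRate` and the off-diagonal ones
are `(-1)^m` times half of `coherence`: a mixture of the Hadamard basis projections for `m` and for
`m + 1`, with weights `flipWeight` at `0` and `1` (`sum_decode_one`). The first weight is at least
`1 - ε` with `ε = 2 εG + 2 εH`, by a union bound for the sets `G` and a weak triangle inequality for
the Hellinger distance through the common density of the claw (`one_sub_le_flipWeight`).

Expanding the tensor product gives nonnegative terms, one for each pattern of flips. Keeping only
the pattern without flips yields `P(accept, m) ≥ (1 - n ε) D(m)` for every `ρ`, entangled or not
(`le_sum_prod_mul_bornWeight`, `le_hadamardRound_apply`). This domination gives both Hadamard round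
claims: summing over `m` bounds the acceptance probability, and conditioning on acceptance only
increases the left side, so the conditioned distribution dominates `(1 - n ε) D` and is within `n ε`
of `D`.

In the test round, outcomes of positive probability have nonzero amplitude in the prepared state,
hence positive density at `y`, which is what `chk` tests. -/

/-! ### Independent draws. -/

theorem independent_apply {α : Type} {n : ℕ} (p : Fin n → PMF α) (v : Fin n → α) :
    independent p v = ∏ i, p i (v i) := by
  classical
  induction n with
  | zero => simp [independent, PMF.pure_apply, Subsingleton.elim v Fin.elim0]
  | succ n ih =>
    have inner (a : α) : ((independent fun i => p i.succ).bind fun u =>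
        PMF.pure (Fin.cons a u : Fin (n + 1) → α)) v
        = if a = v 0 then ∏ i : Fin n, p i.succ (v i.succ) else 0 := by
      rw [PMF.bind_apply, tsum_eq_single (Fin.tail v)]
      · rw [ih, PMF.pure_apply]
        by_cases ha : a = v 0
        · subst ha
          simp [Fin.tail]
        · rw [if_neg ha, if_neg, mul_zero]
          intro h
          exact ha (by simpa using (congrFun h 0).symm)
      · intro u hu
        rw [PMF.pure_apply, if_neg, mul_zero]
        rintro rfl
        exact hu (by simp)
    rw [independent, PMF.bind_apply, tsum_eq_single (v 0)]
    · rw [inner, if_pos rfl, Fin.prod_univ_succ]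
    · intro a ha
      rw [inner, if_neg ha, mul_zero]

theorem mem_support_independent {α : Type} {n : ℕ} {p : Fin n → PMF α} {v : Fin n → α}
    (hv : v ∈ (independent p).support) (i : Fin n) : v i ∈ (p i).support := by
  rw [PMF.mem_support_iff, independent_apply] at hv
  exact (PMF.mem_support_iff _ _).2 (Finset.prod_ne_zero_iff.1 hv i (Finset.mem_univ i))

/-- Probability that all of several independent flagged results are flagged `true` and that the
results are `m`. -/
theorem independent_map_true_apply {n : ℕ} (p : Fin n → PMF (Bool × Bit)) (m : Bits n) :
    ((independent p).map fun v => (decide (∀ i, (v i).1 = true), fun i => (v i).2)) (true, m)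
      = ∏ i, p i (true, m i) := by
  classical
  rw [PMF.map_apply, tsum_eq_single fun i => (true, m i)]
  · simp [independent_apply]
  · intro v hv
    rw [if_neg]
    intro h
    simp only [Prod.mk.injEq, eq_comm (a := true), decide_eq_true_eq] at h
    exact hv (funext fun i => Prod.ext (h.1 i) (congrFun h.2 i).symm)

/-! ### Born weights of measurement outcomes. -/

/-- The value `⟨u| M |u⟩`, where `u` lists the entries of `⟨u|`. -/
def bornWeight {ι : Type} [Fintype ι] (M : Matrix ι ι ℂ) (u : ι → ℂ) : ℂ :=
  ∑ b, ∑ c, u b * M b c * star (u c)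

theorem mul_mul_conjTranspose_apply_self {ι κ : Type} [Fintype ι] (V : Matrix κ ι ℂ)
    (M : Matrix ι ι ℂ) (a : κ) : (V * M * Vᴴ) a a = bornWeight M (V a) := by
  simp only [Matrix.mul_apply, Matrix.conjTranspose_apply, bornWeight, Finset.sum_mul]
  exact Finset.sum_comm

theorem QState.measure_apply {ι : Type} [Fintype ι] (ρ : QState ι) (i : ι) :
    ρ.measure i = ENNReal.ofReal (ρ.mat i i).re := rfl

theorem QState.apply_measure {ι κ : Type} [Fintype ι] [DecidableEq ι] [Fintype κ]
    (ρ : QState ι) (V : LIso ι κ) (a : κ) :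
    (ρ.apply V).measure a = ENNReal.ofReal (bornWeight ρ.mat (V.mat a)).re := by
  exact congrArg (fun z : ℂ => ENNReal.ofReal z.re)
    (mul_mul_conjTranspose_apply_self V.mat ρ.mat a)

theorem QState.bornWeight_nonneg {ι : Type} [Fintype ι] (ρ : QState ι) (u : ι → ℂ) :
    0 ≤ (bornWeight ρ.mat u).re := by
  have h := (ρ.posSemidef.mul_mul_conjTranspose_same (Matrix.of fun _ : Unit => u)).diag_nonneg
    (i := ())
  rw [mul_mul_conjTranspose_apply_self] at h
  exact (Complex.le_def.mp h).1

theorem QState.measureSnd_apply {S C : Type} [Fintype S] [Fintype C] (ρ : QState (S × C)) (c : C) :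
    ρ.measureSnd c = ENNReal.ofReal (ρ.branch c).trace.re := rfl

/-- A positive semidefinite matrix of trace zero vanishes. This allows sums over all outcomes,
including those without a post-measurement state. -/
theorem QState.branch_eq_zero {S C : Type} [Fintype S] [Fintype C] (ρ : QState (S × C)) {c : C}
    (hc : c ∉ ρ.measureSnd.support) : ρ.branch c = 0 := by
  classical
  have h := Complex.le_def.mp (ρ.branch_posSemidef c).trace_nonneg
  rw [PMF.mem_support_iff, not_not, QState.measureSnd_apply, ENNReal.ofReal_eq_zero] at hc
  exact (ρ.branch_posSemidef c).trace_eq_zero_iff.1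
    (Complex.ext (le_antisymm hc h.1) h.2.symm)

theorem bornWeight_smul {ι : Type} [Fintype ι] (r : ℝ) (M : Matrix ι ι ℂ) (u : ι → ℂ) :
    bornWeight (r • M) u = r * bornWeight M u := by
  simp only [bornWeight, Finset.mul_sum, Matrix.smul_apply, Complex.real_smul]
  refine Finset.sum_congr rfl fun b _ => Finset.sum_congr rfl fun c _ => ?_
  ring

theorem bornWeight_zero {ι : Type} [Fintype ι] (u : ι → ℂ) :
    bornWeight (0 : Matrix ι ι ℂ) u = 0 := by
  simp [bornWeight]

/-- Measuring one register and then the other one, after an operation on it: the joint outcome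
probabilities. -/
theorem QState.partialMeasure_bind_apply {S C S' O : Type} [Fintype S] [DecidableEq S] [Fintype C]
    [Fintype S'] (ρ : QState (S × C)) (V : LIso S S') (F : C → S' → PMF O) (o : O) :
    (ρ.partialMeasure.bind fun r => (r.2.apply V).measure.bind fun a => F r.1 a) o
      = ∑ c, ∑ a, ENNReal.ofReal (bornWeight (ρ.branch c) (V.mat a)).re * F c a o := by
  have e : (ρ.partialMeasure.bind fun r => (r.2.apply V).measure.bind fun a => F r.1 a)
      = ρ.measureSnd.bindOnSupport fun c hc => ((ρ.post c hc).apply V).measure.bind (F c) := by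
    rw [QState.partialMeasure, ← PMF.bindOnSupport_eq_bind, PMF.bindOnSupport_bindOnSupport]
    congr 1
    funext c hc
    rw [PMF.bindOnSupport_eq_bind, PMF.pure_bind]
  rw [e, PMF.bindOnSupport_apply, tsum_fintype]
  refine Finset.sum_congr rfl fun c _ => ?_
  split_ifs with hc
  · rw [ρ.branch_eq_zero (by rwa [PMF.mem_support_iff, not_not])]
    simp [bornWeight_zero]
  · rw [PMF.bind_apply, tsum_fintype, Finset.mul_sum]
    refine Finset.sum_congr rfl fun a _ => ?_
    have hpost : (ρ.post c hc).mat = ((ρ.branch c).trace.re⁻¹ : ℝ) • ρ.branch c := rfl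
    -- The normalisation of the post-measurement state cancels against the probability of `c`.
    rw [← mul_assoc, QState.apply_measure, hpost, bornWeight_smul, Complex.re_ofReal_mul,
      QState.measureSnd_apply, ← ENNReal.ofReal_mul]
    · congr 2
      rw [QState.measureSnd_apply, ENNReal.ofReal_eq_zero, not_le] at hc
      rw [mul_inv_cancel_left₀ hc.ne']
    · exact (Complex.le_def.mp (ρ.branch_posSemidef c).trace_nonneg).1

/-- Weighted sum over product effects. -/
theorem sum_prod_mul_bornWeight {ι A : Type} [Fintype ι] [Fintype A] {n : ℕ}
    (M : Matrix (Fin n → ι) (Fin n → ι) ℂ) (α : Fin n → A → ℂ) (N : Fin n → A → ι → ℂ) :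
    ∑ a : Fin n → A, (∏ i, α i (a i)) * bornWeight M (fun b => ∏ i, N i (a i) (b i))
      = ∑ b, ∑ c, M b c * ∏ i, ∑ a, α i a * (N i a (b i) * star (N i a (c i))) := by
  simp only [bornWeight, Finset.mul_sum]
  rw [Finset.sum_comm]
  refine Finset.sum_congr rfl fun b _ => ?_
  rw [Finset.sum_comm]
  refine Finset.sum_congr rfl fun c _ => ?_
  rw [Fintype.prod_sum, Finset.mul_sum]
  refine Finset.sum_congr rfl fun a _ => ?_
  simp only [star_prod, Finset.prod_mul_distrib]
  ring

/-- If on every qubit the weighted effects `N` amount to the effect of `U` for `m`, up to flips,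
then the weighted product effects amount to that of the product of the `U`, up to flips. -/
theorem le_sum_prod_mul_bornWeight {A : Type} [Fintype A] {n : ℕ} (ρ : QState (Bits n))
    (α : Fin n → A → ℝ) (N : Fin n → A → Bit → ℂ) (U : Fin n → Bit → Bit → ℂ) (r : Fin n → Bit → ℝ)
    (hr : ∀ i s, 0 ≤ r i s) (m : Bits n)
    (h : ∀ i b c, ∑ a, (α i a : ℂ) * (N i a b * star (N i a c))
      = ∑ s, (r i s : ℂ) * (U i (m i + s) b * star (U i (m i + s) c))) :
    (∏ i, r i 0) * (bornWeight ρ.mat fun b => ∏ i, U i (m i) (b i)).re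
      ≤ ∑ a : Fin n → A, (∏ i, α i (a i)) *
        (bornWeight ρ.mat fun b => ∏ i, N i (a i) (b i)).re := by
  have key : ∑ a : Fin n → A, (∏ i, α i (a i)) *
        (bornWeight ρ.mat fun b => ∏ i, N i (a i) (b i)).re
      = ∑ s : Bits n, (∏ i, r i (s i)) *
        (bornWeight ρ.mat fun b => ∏ i, U i (m i + s i) (b i)).re := by
    -- The same expansion is used in both directions: its right side depends only on the
    -- single-qubit effects, which `h` identifies with mixtures of flipped effects of `U`.
    have e := sum_prod_mul_bornWeight ρ.mat (fun i a => (α i a : ℂ)) N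
    simp only [h] at e
    rw [← sum_prod_mul_bornWeight ρ.mat (fun i a => (r i a : ℂ))
      (fun i s => U i (m i + s))] at e
    have e' := congrArg Complex.re e
    simp only [← Complex.ofReal_prod, Complex.re_sum, Complex.re_ofReal_mul] at e'
    exact e'
  rw [key]
  -- Every pattern `s` of flips contributes a nonnegative term; only `s = 0` is kept.
  have := Finset.single_le_sum (f := fun s : Bits n => (∏ i, r i (s i)) *
        (bornWeight ρ.mat fun b => ∏ i, U i (m i + s i) (b i)).re)
    (fun s _ => mul_nonneg (Finset.prod_nonneg fun i _ => hr i _) (ρ.bornWeight_nonneg _))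
    (Finset.mem_univ 0)
  simpa using this

/-! ### Densities and Hellinger distance -/

theorem sum_toReal_eq_one {α : Type} [Fintype α] (p : PMF α) : ∑ a, (p a).toReal = 1 := by
  rw [← ENNReal.toReal_sum fun a _ => p.apply_ne_top a, ← tsum_fintype (L := .unconditional α),
    p.tsum_coe, ENNReal.toReal_one]

/-- Square roots of densities are unit vectors, so one minus their inner product is half their
squared Euclidean distance. -/
theorem hellingerSq_eq_sum_sq {α : Type} [Fintype α] (p q : PMF α) :
    hellingerSq p q = 1 / 2 * ∑ a, (Real.sqrt (p a).toReal - Real.sqrt (q a).toReal) ^ 2 := by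
  have h : ∀ a, (Real.sqrt (p a).toReal - Real.sqrt (q a).toReal) ^ 2
      = (p a).toReal + (q a).toReal - 2 * Real.sqrt ((p a).toReal * (q a).toReal) := by
    intro a
    rw [Real.sqrt_mul ENNReal.toReal_nonneg, sub_sq, Real.sq_sqrt ENNReal.toReal_nonneg,
      Real.sq_sqrt ENNReal.toReal_nonneg]
    ring
  simp only [h, Finset.sum_sub_distrib, Finset.sum_add_distrib, sum_toReal_eq_one,
    ← Finset.mul_sum, hellingerSq]
  ring

theorem hellingerSq_nonneg {α : Type} [Fintype α] (p q : PMF α) : 0 ≤ hellingerSq p q := by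
  rw [hellingerSq_eq_sum_sq]
  positivity

theorem hellingerSq_comm {α : Type} [Fintype α] (p q : PMF α) :
    hellingerSq p q = hellingerSq q p := by
  simp only [hellingerSq, mul_comm]

/-- The triangle inequality with the loss from `(u + v)² ≤ 2u² + 2v²`, which avoids square roots in
the final bound. -/
theorem hellingerSq_le_two_mul_add {α : Type} [Fintype α] (p q r : PMF α) :
    hellingerSq p r ≤ 2 * hellingerSq p q + 2 * hellingerSq q r := by
  simp only [hellingerSq_eq_sum_sq]
  have : ∑ a, (Real.sqrt (p a).toReal - Real.sqrt (r a).toReal) ^ 2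
      ≤ ∑ a, (2 * (Real.sqrt (p a).toReal - Real.sqrt (q a).toReal) ^ 2
        + 2 * (Real.sqrt (q a).toReal - Real.sqrt (r a).toReal) ^ 2) := by
    refine Finset.sum_le_sum fun a _ => ?_
    nlinarith [sq_nonneg ((Real.sqrt (p a).toReal - Real.sqrt (q a).toReal)
      - (Real.sqrt (q a).toReal - Real.sqrt (r a).toReal))]
  rw [Finset.sum_add_distrib, ← Finset.mul_sum, ← Finset.mul_sum] at this
  linarith

/-! ### Signs and Hadamard gates -/

/-- The sign `(-1)^s`. -/
def bitSign (s : Bit) : ℝ := if s = 1 then -1 else 1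

theorem bitSign_zero : bitSign 0 = 1 := by simp [bitSign]

theorem bitSign_one : bitSign 1 = -1 := by simp [bitSign]

theorem bit_eq_zero_or_one : ∀ s : Bit, s = 0 ∨ s = 1 := by decide

theorem sum_bit {M : Type} [AddCommMonoid M] (f : Bit → M) : ∑ s, f s = f 0 + f 1 := by
  have e : (Finset.univ : Finset Bit) = {0, 1} := by decide
  rw [e, Finset.sum_pair (by decide)]

theorem bitSign_add (s t : Bit) : bitSign (s + t) = bitSign s * bitSign t := by
  have h : (1 : Bit) + 1 = 0 := by decide
  rcases bit_eq_zero_or_one s with rfl | rfl <;> rcases bit_eq_zero_or_one t with rfl | rfl <;>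
    simp [bitSign_zero, bitSign_one, h]

theorem bitSign_mul_self (s : Bit) : bitSign s * bitSign s = 1 := by
  rcases bit_eq_zero_or_one s with rfl | rfl <;> simp [bitSign_zero, bitSign_one]

theorem bitSign_sum {ι : Type} (s : Finset ι) (f : ι → Bit) :
    bitSign (∑ i ∈ s, f i) = ∏ i ∈ s, bitSign (f i) := by
  classical
  induction s using Finset.induction_on with
  | empty => simp [bitSign_zero]
  | insert i s hi ih => rw [Finset.sum_insert hi, Finset.prod_insert hi, bitSign_add, ih]

theorem hadamard_apply (a b : Bit) :
    hadamard.mat a b = (((Real.sqrt 2)⁻¹ * bitSign (a * b) : ℝ) : ℂ) := by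
  rcases bit_eq_zero_or_one a with rfl | rfl <;> rcases bit_eq_zero_or_one b with rfl | rfl <;>
    simp [hadamard, bitSign_zero, bitSign_one]

theorem tensor_apply {ι κ : Type} [Fintype ι] [DecidableEq ι] [Fintype κ] {n : ℕ}
    (A : Fin n → LIso ι κ) (a : Fin n → κ) (b : Fin n → ι) :
    (LIso.tensor A).mat a b = ∏ i, (A i).mat (a i) (b i) := rfl

theorem tensor_hadamard_apply {w : ℕ} (d z : Bits w) :
    (LIso.tensor fun _ => hadamard).mat d z
      = (((Real.sqrt 2)⁻¹ ^ w * bitSign (d ⬝ᵥ z) : ℝ) : ℂ) := by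
  rw [tensor_apply]
  simp only [hadamard_apply]
  rw [← Complex.ofReal_prod, Finset.prod_mul_distrib, dotProduct, bitSign_sum]
  simp

/-! ### One qubit of the honest prover -/

section Qubit

variable {X Y : Type} [Fintype X] [Fintype Y]

/-- The part of the commitment to one qubit that belongs to the commitment string `y`. -/
def commitBranch (s : Bit → PureState (X × Y)) (y : Y) : Matrix (Bit × X) Bit ℂ :=
  Matrix.of fun r b => if r.1 = b then (s b).vec (r.2, y) else 0

/-- Composition of operations. -/
def LIso.comp {ι κ τ : Type} [Fintype ι] [DecidableEq ι] [Fintype κ] [DecidableEq κ] [Fintype τ]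
    (B : LIso κ τ) (A : LIso ι κ) : LIso ι τ where
  mat := B.mat * A.mat
  isometry := by
    rw [Matrix.conjTranspose_mul, Matrix.mul_assoc, ← Matrix.mul_assoc _ B.mat, B.isometry,
      Matrix.one_mul, A.isometry]

variable [DecidableEq X] {w : ℕ}

/-- What is applied to one committed qubit before the measurement in a Hadamard round. -/
def hadamardStep (J : X ↪ Bits w) : LIso (Bit × X) (Bit × Bits w) :=
  (hadamard.prod (LIso.tensor fun _ => hadamard)).comp (applyJ J)

/-- Amplitudes of the answers for one qubit in a Hadamard round, given the commitment string. -/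
def answerAmp (s : Bit → PureState (X × Y)) (J : X ↪ Bits w) (y : Y) :
    Matrix (Bit × Bits w) Bit ℂ :=
  (hadamardStep J).mat * commitBranch s y

theorem hadamardStep_apply (J : X ↪ Bits w) (a : Bit × Bits w) (r : Bit × X) :
    (hadamardStep J).mat a r
      = (((Real.sqrt 2)⁻¹ ^ (w + 1) * bitSign (a.1 * r.1 + a.2 ⬝ᵥ J r.2) : ℝ) : ℂ) := by
  have h : (hadamardStep J).mat a r
      = ∑ q, (hadamard.prod (LIso.tensor fun _ => hadamard)).mat a q * (applyJ J).mat q r := rfl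
  have h2 : ∀ q, (applyJ J).mat q r = if q = (r.1, J r.2) then 1 else 0 := fun q => rfl
  have h3 : ∀ q, (hadamard.prod (LIso.tensor fun _ : Fin w => hadamard)).mat a q
      = hadamard.mat a.1 q.1 * (LIso.tensor fun _ => hadamard).mat a.2 q.2 := fun q => rfl
  rw [h]
  simp only [h2, h3, mul_ite, mul_one, mul_zero, Finset.sum_ite_eq', Finset.mem_univ, if_true]
  rw [hadamard_apply, tensor_hadamard_apply, ← Complex.ofReal_mul, bitSign_add]
  congr 1
  ring

theorem answerAmp_apply (s : Bit → PureState (X × Y)) (J : X ↪ Bits w) (y : Y)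
    (a : Bit × Bits w) (b : Bit) :
    answerAmp s J y a b = ∑ x,
      (((Real.sqrt 2)⁻¹ ^ (w + 1) * bitSign (a.1 * b + a.2 ⬝ᵥ J x) : ℝ) : ℂ)
        * (s b).vec (x, y) := by
  rw [answerAmp, Matrix.mul_apply, Fintype.sum_prod_type, Finset.sum_eq_single b]
  · simp [commitBranch, hadamardStep_apply]
  · intro c _ hc
    simp [commitBranch, hc]
  · simp

/-- The operation before the measurement is an isometry, so the sum over all answers is the Gram
matrix of `commitBranch`. It is diagonal because the committed qubit stays in the register as the
control. -/
theorem sum_answerAmp_mul_star (s : Bit → PureState (X × Y)) (J : X ↪ Bits w) (y : Y)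
    (b c : Bit) :
    ∑ a, answerAmp s J y a b * star (answerAmp s J y a c)
      = if b = c then ((∑ x, ‖(s b).vec (x, y)‖ ^ 2 : ℝ) : ℂ) else 0 := by
  have h : (answerAmp s J y)ᴴ * answerAmp s J y = (commitBranch s y)ᴴ * commitBranch s y := by
    rw [answerAmp, Matrix.conjTranspose_mul, Matrix.mul_assoc,
      ← Matrix.mul_assoc _ (hadamardStep J).mat, (hadamardStep J).isometry, Matrix.one_mul]
  have h' := congrFun (congrFun h c) b
  simp only [Matrix.mul_apply, Matrix.conjTranspose_apply] at h'
  simp only [mul_comm (answerAmp s J y _ b)]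
  rw [h', Fintype.sum_prod_type, Finset.sum_eq_single c]
  · by_cases hbc : b = c
    · subst hbc
      simp [commitBranch, Complex.conj_mul']
    · simp [commitBranch, hbc, Ne.symm hbc]
  · intro a _ ha
    simp [commitBranch, ha]
  · simp

end Qubit

/-! ### Stored results -/

section Families

variable {X Y K T : ℕ → Type} [∀ l, Fintype (X l)] [∀ l, Fintype (Y l)] {w : ℕ → ℕ}

/-- Makes `1 / |X|` meaningful: the domain is nonempty because a normalised prepared state exists.
-/
theorem nonempty_of_pureState {ι κ : Type} [Fintype ι] [Fintype κ] (s : PureState (ι × κ)) :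
    Nonempty ι := by
  by_contra h
  rw [not_nonempty_iff] at h
  simpa using s.norm_one

theorem reject_apply_true (m : Bit) :
    ((PMF.uniformOfFintype Bit).map fun r => (false, r)) (true, m) = 0 := by
  rw [← not_not (a := _ = _), ← ne_eq, ← PMF.mem_support_iff]
  simp

theorem decode_zero_apply (E : ExtendedTCF X Y K T w) (l : ℕ) (k : K l) (t : T l) (y : Y l)
    (a : Bit × Bits (w l)) (m b : Bit) (x : X l) (hy : E.I.inv l t y = some (b, x)) :
    decode E l 0 k t y a (true, m) = if m = b then 1 else 0 := by
  simp [decode, hy, PMF.pure_apply]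

open Classical in
theorem decode_one_apply (E : ExtendedTCF X Y K T w) (l : ℕ) (k : K l) (t : T l) (y : Y l)
    (a : Bit × Bits (w l)) (m : Bit) (x₀ x₁ : X l) (h0 : E.F.inv l t 0 y = some x₀)
    (h1 : E.F.inv l t 1 y = some x₁) :
    decode E l 1 k t y a (true, m) =
      if a.2 ∈ E.F.G l k 0 x₀ ∩ E.F.G l k 1 x₁ ∧ m = a.1 + a.2 ⬝ᵥ (E.F.J l x₀ + E.F.J l x₁)
      then 1 else 0 := by
  simp only [decode, h0, h1, if_neg (one_ne_zero (α := Bit))]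
  split_ifs with hG h h
  · rw [← h.2, PMF.pure_apply, if_pos rfl]
  · rw [PMF.pure_apply, if_neg]
    intro e
    exact h ⟨hG, (Prod.ext_iff.1 e).2⟩
  · exact absurd h.1 hG
  · exact reject_apply_true m

/-- For a key of the injective family the stored result is that of a standard basis measurement. -/
theorem sum_decode_zero [∀ l, DecidableEq (X l)]
    (E : ExtendedTCF X Y K T w) (l : ℕ) (kt : K l × T l)
    (hkt : kt ∈ (E.I.gen l).support) (m b c : Bit) :
    ∑ r : Y l × (Bit × Bits (w l)),
        ((decode E l 0 kt.1 kt.2 r.1 r.2 (true, m)).toReal : ℂ) *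
          (answerAmp (E.F.samp l kt.1) (E.F.J l) r.1 r.2 b *
            star (answerAmp (E.F.samp l kt.1) (E.F.J l) r.1 r.2 c))
      = (LIso.id Bit).mat m b * star ((LIso.id Bit).mat m c) := by
  have hne := nonempty_of_pureState (E.F.samp l kt.1 0)
  have hvec : ∀ b x y, ‖(E.F.samp l kt.1 b).vec (x, y)‖ ^ 2
      = 1 / Fintype.card (X l) * (E.I.g l kt.1 b x y).toReal := by
    intro b x y
    rw [E.samp_same, E.I.samp_eq l kt hkt, Complex.norm_real, Real.norm_eq_abs, sq_abs, mul_pow,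
      Real.sq_sqrt ENNReal.toReal_nonneg, div_pow, Real.sq_sqrt (Nat.cast_nonneg _), one_pow]
  have hy : ∀ y, ∑ a, ((decode E l 0 kt.1 kt.2 y a (true, m)).toReal : ℂ) *
          (answerAmp (E.F.samp l kt.1) (E.F.J l) y a b *
            star (answerAmp (E.F.samp l kt.1) (E.F.J l) y a c))
      = (if m = b then 1 else 0) * ∑ a, (answerAmp (E.F.samp l kt.1) (E.F.J l) y a b *
            star (answerAmp (E.F.samp l kt.1) (E.F.J l) y a c)) := by
    intro y
    -- Either `y` inverts to control bit `b`, so that decoding yields `b`, or the branch of `b` has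
    -- amplitude zero at `y`.
    by_cases hs : ∃ x, E.I.g l kt.1 b x y ≠ 0
    · obtain ⟨x, hx⟩ := hs
      rw [Finset.mul_sum]
      refine Finset.sum_congr rfl fun a _ => ?_
      rw [decode_zero_apply E l kt.1 kt.2 y a m b x
        (E.I.inv_eq l kt hkt b x y ((PMF.mem_support_iff _ _).2 hx))]
      split_ifs <;> simp
    · push Not at hs
      have hz : ∀ a, answerAmp (E.F.samp l kt.1) (E.F.J l) y a b = 0 := by
        intro a
        rw [answerAmp_apply]
        refine Finset.sum_eq_zero fun x _ => ?_
        have := hvec b x y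
        rw [hs x] at this
        simp only [ENNReal.toReal_zero, mul_zero] at this
        rw [norm_eq_zero.1 (pow_eq_zero_iff two_ne_zero |>.1 this), mul_zero]
      simp [hz]
  rw [Fintype.sum_prod_type]
  simp only [hy, sum_answerAmp_mul_star, hvec]
  rw [← Finset.mul_sum]
  by_cases hbc : b = c
  · subst hbc
    simp only [if_true]
    rw [← Complex.ofReal_sum, Finset.sum_comm]
    simp only [← Finset.mul_sum, sum_toReal_eq_one]
    simp only [LIso.id, Matrix.one_apply]
    split_ifs <;> simp
  · simp only [hbc, if_false, Finset.sum_const_zero, mul_zero, LIso.id, Matrix.one_apply]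
    split_ifs with h1 h2 <;> simp_all

/-! ### The effect of a stored result for a claw-free key. -/

/-- The preimage under `f_{k,b}` in the claw numbered by the preimage under `f_{k,0}`. -/
def clawPoint (F : NTCF X Y K T w) (l : ℕ) (k : K l) (b : Bit) : X l ≃ X l :=
  if b = 0 then Equiv.refl _ else F.matching l k

/-- The conclusion does not depend on `b`: both branches of a claw lead the verifier to the same
claw. -/
theorem inv_of_mem_support (F : NTCF X Y K T w) (l : ℕ) (kt : K l × T l)
    (hkt : kt ∈ (F.gen l).support) (b : Bit) (z : X l) (y : Y l)
    (hy : F.fApprox l kt.1 b (clawPoint F l kt.1 b z) y ≠ 0) :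
    F.inv l kt.2 0 y = some z ∧ F.inv l kt.2 1 y = some (F.matching l kt.1 z) := by
  rcases bit_eq_zero_or_one b with rfl | rfl
  · exact F.inv_approx_zero l kt hkt z _ rfl y ((PMF.mem_support_iff _ _).2 hy)
  · exact (F.inv_approx_one l kt hkt z _ rfl y ((PMF.mem_support_iff _ _).2 hy)).symm

/-- Square root of the density that is used in place of `f_{k,b}`, along the claws. -/
def rootDensity (F : NTCF X Y K T w) (l : ℕ) (k : K l) (b : Bit) (z : X l) (y : Y l) : ℝ :=
  Real.sqrt (F.fApprox l k b (clawPoint F l k b z) y).toReal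

/-- Overlap of the two densities of a claw. -/
def clawOverlap (F : NTCF X Y K T w) (l : ℕ) (k : K l) (z : X l) : ℝ :=
  ∑ y, rootDensity F l k 0 z y * rootDensity F l k 1 z y

theorem sum_rootDensity_mul (F : NTCF X Y K T w) (l : ℕ) (k : K l) (b c : Bit) (z : X l) :
    ∑ y, rootDensity F l k b z y * rootDensity F l k c z y
      = if b = c then 1 else clawOverlap F l k z := by
  rcases bit_eq_zero_or_one b with rfl | rfl <;> rcases bit_eq_zero_or_one c with rfl | rfl
  · simp [rootDensity, Real.mul_self_sqrt ENNReal.toReal_nonneg, sum_toReal_eq_one]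
  · simp [clawOverlap]
  · simp [clawOverlap, mul_comm]
  · simp [rootDensity, Real.mul_self_sqrt ENNReal.toReal_nonneg, sum_toReal_eq_one]

/-- The strings that pass the check for a claw. -/
def goodStrings (F : NTCF X Y K T w) (l : ℕ) (k : K l) (z : X l) : Set (Bits (w l)) :=
  F.G l k 0 z ∩ F.G l k 1 (F.matching l k z)

open Classical in
/-- Whether an answer for a qubit passes and gives the result `m`. -/
def claimWeight (F : NTCF X Y K T w) (l : ℕ) (k : K l) (m : Bit) (z : X l)
    (a : Bit × Bits (w l)) : ℝ :=
  if a.2 ∈ goodStrings F l k z ∧ m = a.1 + a.2 ⬝ᵥ (F.J l z + F.J l (F.matching l k z))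
  then 1 else 0

/-- For each string `d` that passes, exactly one bit `b'` makes the stored result equal to `m`. -/
theorem sum_claimWeight (F : NTCF X Y K T w) (l : ℕ) (k : K l) (m : Bit) (z : X l) :
    ∑ a, claimWeight F l k m z a = (goodStrings F l k z).ncard := by
  classical
  have h : ∀ d, ∑ b', claimWeight F l k m z (b', d) = if d ∈ goodStrings F l k z then 1 else 0 := by
    intro d
    set δ := d ⬝ᵥ (F.J l z + F.J l (F.matching l k z)) with hδ
    rw [Finset.sum_eq_single (m - δ)]
    · simp [claimWeight, ← hδ]
    · intro b' _ hb
      rw [claimWeight, if_neg]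
      rintro ⟨-, rfl⟩
      exact hb (by simp [hδ])
    · simp
  rw [Fintype.sum_prod_type_right]
  simp only [h]
  rw [Finset.sum_boole, Set.ncard_eq_toFinset_card']
  congr 2
  ext d
  simp

/-- The phase that carries the logical result: for `b ≠ c` the exponents add up to `b' + d·(J x₀ + J
x₁)`, the bit the verifier stores, while for `b = c` the signs cancel. -/
theorem claimWeight_mul_bitSign (F : NTCF X Y K T w) (l : ℕ) (k : K l) (m b c : Bit) (z : X l)
    (a : Bit × Bits (w l)) :
    claimWeight F l k m z a * (bitSign (a.1 * b + a.2 ⬝ᵥ F.J l (clawPoint F l k b z)) *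
      bitSign (a.1 * c + a.2 ⬝ᵥ F.J l (clawPoint F l k c z)))
      = claimWeight F l k m z a * if b = c then 1 else bitSign m := by
  by_cases hbc : b = c
  · subst hbc
    simp [bitSign_mul_self]
  · rw [claimWeight]
    split_ifs with h
    · rw [← bitSign_add, h.2, dotProduct_add]
      congr 2
      rcases bit_eq_zero_or_one b with rfl | rfl <;> rcases bit_eq_zero_or_one c with rfl | rfl
      · exact absurd rfl hbc
      · simp [clawPoint]; ring
      · simp [clawPoint]; ring
      · exact absurd rfl hbc
    · simp

/-- Reindexing the preimages of each branch by claws gives both branches the same summation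
variable. -/
theorem answerAmp_eq [∀ l, DecidableEq (X l)] (F : NTCF X Y K T w) (l : ℕ) (kt : K l × T l)
    (hkt : kt ∈ (F.gen l).support) (y : Y l) (a : Bit × Bits (w l)) (b : Bit) :
    answerAmp (F.samp l kt.1) (F.J l) y a b =
      (((Real.sqrt 2)⁻¹ ^ (w l + 1) / Real.sqrt (Fintype.card (X l)) *
        ∑ z, bitSign (a.1 * b + a.2 ⬝ᵥ F.J l (clawPoint F l kt.1 b z)) *
          rootDensity F l kt.1 b z y : ℝ) : ℂ) := by
  rw [answerAmp_apply, ← Equiv.sum_comp (clawPoint F l kt.1 b), Finset.mul_sum,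
    Complex.ofReal_sum]
  refine Finset.sum_congr rfl fun z _ => ?_
  rw [F.samp_eq l kt hkt, ← Complex.ofReal_mul, rootDensity]
  congr 1
  ring

/-- Real form of one entry of the effect of a stored result. -/
theorem decode_mul_sum_mul_sum (E : ExtendedTCF X Y K T w) (l : ℕ) (kt : K l × T l)
    (hkt : kt ∈ (E.F.gen l).support) (m b c : Bit) (y : Y l) (a : Bit × Bits (w l)) :
    (decode E l 1 kt.1 kt.2 y a (true, m)).toReal *
      ((∑ z, bitSign (a.1 * b + a.2 ⬝ᵥ E.F.J l (clawPoint E.F l kt.1 b z)) *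
          rootDensity E.F l kt.1 b z y) *
        ∑ z, bitSign (a.1 * c + a.2 ⬝ᵥ E.F.J l (clawPoint E.F l kt.1 c z)) *
          rootDensity E.F l kt.1 c z y)
      = ∑ z, (claimWeight E.F l kt.1 m z a * if b = c then 1 else bitSign m) *
          (rootDensity E.F l kt.1 b z y * rootDensity E.F l kt.1 c z y) := by
  have hinv : ∀ b z, rootDensity E.F l kt.1 b z y ≠ 0 →
      E.F.inv l kt.2 0 y = some z ∧ E.F.inv l kt.2 1 y = some (E.F.matching l kt.1 z) := by
    intro b z hz
    refine inv_of_mem_support E.F l kt hkt b z y fun h0 => hz ?_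
    rw [rootDensity, h0]
    simp
  rw [Finset.sum_mul_sum, Finset.mul_sum]
  refine Finset.sum_congr rfl fun z _ => ?_
  -- Cross terms between different claws vanish: `y` would otherwise have two inverses under `0`.
  rw [Finset.sum_eq_single z]
  · by_cases hz : rootDensity E.F l kt.1 b z y = 0
    · simp [hz]
    · have hd : (decode E l 1 kt.1 kt.2 y a (true, m)).toReal = claimWeight E.F l kt.1 m z a := by
        rw [decode_one_apply E l kt.1 kt.2 y a m _ _ (hinv b z hz).1 (hinv b z hz).2, claimWeight,
          goodStrings]
        split_ifs <;> simp
      rw [hd, ← claimWeight_mul_bitSign]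
      ring
  · intro z' _ hne
    by_cases hz : rootDensity E.F l kt.1 b z y = 0
    · simp [hz]
    · by_cases hz' : rootDensity E.F l kt.1 c z' y = 0
      · simp [hz']
      · exact absurd (Option.some.inj ((hinv c z' hz').1.symm.trans (hinv b z hz).1)) hne
  · simp

/-- Probability that the string of a claw passes the check, averaged over the claws. -/
def passRate (F : NTCF X Y K T w) (l : ℕ) (k : K l) : ℝ :=
  ∑ z, (goodStrings F l k z).ncard / (2 ^ w l * Fintype.card (X l) : ℝ)

/-- The same average, weighted with the overlaps of the claws. -/
def coherence (F : NTCF X Y K T w) (l : ℕ) (k : K l) : ℝ :=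
  ∑ z, clawOverlap F l k z * ((goodStrings F l k z).ncard / (2 ^ w l * Fintype.card (X l) : ℝ))

/-- Weight of the correct (`s = 0`) and of the flipped (`s = 1`) result. -/
def flipWeight (F : NTCF X Y K T w) (l : ℕ) (k : K l) (s : Bit) : ℝ :=
  (passRate F l k + bitSign s * coherence F l k) / 2

/-- Both sides have diagonal entries `passRate / 2` and off-diagonal entries `bitSign m * coherence
/ 2`. The diagonal sees only the checks, whereas the off-diagonal also loses the overlap of the two
densities of each claw. -/
theorem sum_decode_one [∀ l, DecidableEq (X l)] (E : ExtendedTCF X Y K T w) (l : ℕ) (kt : K l × T l)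
    (hkt : kt ∈ (E.F.gen l).support) (m b c : Bit) :
    ∑ r : Y l × (Bit × Bits (w l)),
        ((decode E l 1 kt.1 kt.2 r.1 r.2 (true, m)).toReal : ℂ) *
          (answerAmp (E.F.samp l kt.1) (E.F.J l) r.1 r.2 b *
            star (answerAmp (E.F.samp l kt.1) (E.F.J l) r.1 r.2 c))
      = ∑ s, (flipWeight E.F l kt.1 s : ℂ) *
          (hadamard.mat (m + s) b * star (hadamard.mat (m + s) c)) := by
  set C : ℝ := (Real.sqrt 2)⁻¹ ^ (w l + 1) / Real.sqrt (Fintype.card (X l)) with hC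
  -- The factors come from the Hadamard gate on the qubit, the `w` gates on the preimage register,
  -- and the uniform superposition over the domain.
  have hC2 : C * C = (1 / 2) * (1 / (2 ^ w l * Fintype.card (X l))) := by
    have h2 : (Real.sqrt 2)⁻¹ * (Real.sqrt 2)⁻¹ = 1 / 2 := by
      rw [← mul_inv, Real.mul_self_sqrt (by norm_num)]; norm_num
    rw [hC, div_mul_div_comm, Real.mul_self_sqrt (Nat.cast_nonneg _), ← mul_pow, h2, pow_succ,
      one_div_pow]
    ring
  have hl : ∀ y a, ((decode E l 1 kt.1 kt.2 y a (true, m)).toReal : ℂ) *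
          (answerAmp (E.F.samp l kt.1) (E.F.J l) y a b *
            star (answerAmp (E.F.samp l kt.1) (E.F.J l) y a c))
      = ((C * C * ∑ z, (claimWeight E.F l kt.1 m z a * if b = c then 1 else bitSign m) *
          (rootDensity E.F l kt.1 b z y * rootDensity E.F l kt.1 c z y) : ℝ) : ℂ) := by
    intro y a
    rw [← decode_mul_sum_mul_sum E l kt hkt, answerAmp_eq E.F l kt hkt, answerAmp_eq E.F l kt hkt,
      Complex.star_def, Complex.conj_ofReal, ← Complex.ofReal_mul, ← Complex.ofReal_mul]
    congr 1
    ring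
  have hr : ∀ s, (flipWeight E.F l kt.1 s : ℂ) *
          (hadamard.mat (m + s) b * star (hadamard.mat (m + s) c))
      = ((flipWeight E.F l kt.1 s * (1 / 2 * (bitSign ((m + s) * b) * bitSign ((m + s) * c))) : ℝ)
          : ℂ) := by
    intro s
    have h2 : (Real.sqrt 2)⁻¹ * (Real.sqrt 2)⁻¹ = 1 / 2 := by
      rw [← mul_inv, Real.mul_self_sqrt (by norm_num)]; norm_num
    rw [hadamard_apply, hadamard_apply, Complex.star_def, Complex.conj_ofReal,
      ← Complex.ofReal_mul, ← Complex.ofReal_mul, ← h2]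
    congr 1
    ring
  simp only [hl, hr, Fintype.sum_prod_type (f := fun r : Y l × (Bit × Bits (w l)) => _)]
  simp only [← Complex.ofReal_sum]
  congr 1
  have hsum : ∑ y : Y l, ∑ a, C * C * ∑ z, (claimWeight E.F l kt.1 m z a *
        if b = c then 1 else bitSign m) *
          (rootDensity E.F l kt.1 b z y * rootDensity E.F l kt.1 c z y)
      = C * C * ∑ z, ((goodStrings E.F l kt.1 z).ncard * if b = c then 1 else bitSign m) *
          if b = c then 1 else clawOverlap E.F l kt.1 z := by
    simp only [← Finset.mul_sum]
    congr 1
    calc _ = ∑ y : Y l, ∑ z, ∑ a, (claimWeight E.F l kt.1 m z a *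
          if b = c then 1 else bitSign m) *
          (rootDensity E.F l kt.1 b z y * rootDensity E.F l kt.1 c z y) :=
          Finset.sum_congr rfl fun y _ => Finset.sum_comm
      _ = ∑ z, ∑ y : Y l, ∑ a, (claimWeight E.F l kt.1 m z a *
          if b = c then 1 else bitSign m) *
          (rootDensity E.F l kt.1 b z y * rootDensity E.F l kt.1 c z y) := Finset.sum_comm
      _ = _ := by
          refine Finset.sum_congr rfl fun z _ => ?_
          simp only [← Finset.sum_mul, sum_claimWeight, ← Finset.mul_sum, sum_rootDensity_mul]
  rw [hsum, hC2, sum_bit]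
  by_cases hbc : b = c
  · subst hbc
    simp only [if_true, bitSign_mul_self, flipWeight, bitSign_zero, bitSign_one, passRate,
      ← Finset.sum_div, mul_one]
    ring
  -- One of `b`, `c` is `0` and the other is `1`.
  · have hs : ∀ s, bitSign (s * b) * bitSign (s * c) = bitSign s := by
      intro s
      rcases bit_eq_zero_or_one b with rfl | rfl <;> rcases bit_eq_zero_or_one c with rfl | rfl
      · exact absurd rfl hbc
      · simp [bitSign_zero]
      · simp [bitSign_zero]
      · exact absurd rfl hbc
    have hco : coherence E.F l kt.1 = (∑ z, (goodStrings E.F l kt.1 z).ncard *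
        clawOverlap E.F l kt.1 z) / (2 ^ w l * Fintype.card (X l)) := by
      rw [coherence, Finset.sum_div]
      exact Finset.sum_congr rfl fun z _ => by ring
    simp only [hbc, if_false, hs, bitSign_add, bitSign_zero, bitSign_one, flipWeight, hco]
    have : ∑ z, ((goodStrings E.F l kt.1 z).ncard * bitSign m) * clawOverlap E.F l kt.1 z
        = bitSign m * ∑ z, (goodStrings E.F l kt.1 z).ncard * clawOverlap E.F l kt.1 z := by
      rw [Finset.mul_sum]
      exact Finset.sum_congr rfl fun z _ => by ring
    rw [this]
    ring

/-! ### Bounds on the weights of correct and flipped results. -/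

theorem clawOverlap_eq (F : NTCF X Y K T w) (l : ℕ) (k : K l) (z : X l) :
    clawOverlap F l k z
      = 1 - hellingerSq (F.fApprox l k 0 z) (F.fApprox l k 1 (F.matching l k z)) := by
  simp only [clawOverlap, hellingerSq, rootDensity, sub_sub_cancel,
    ← Real.sqrt_mul ENNReal.toReal_nonneg]
  rfl

theorem clawOverlap_nonneg (F : NTCF X Y K T w) (l : ℕ) (k : K l) (z : X l) :
    0 ≤ clawOverlap F l k z :=
  Finset.sum_nonneg fun _ _ => mul_nonneg (Real.sqrt_nonneg _) (Real.sqrt_nonneg _)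

theorem clawOverlap_le_one (F : NTCF X Y K T w) (l : ℕ) (k : K l) (z : X l) :
    clawOverlap F l k z ≤ 1 := by
  rw [clawOverlap_eq]
  linarith [hellingerSq_nonneg (F.fApprox l k 0 z) (F.fApprox l k 1 (F.matching l k z))]

theorem passRate_eq (F : NTCF X Y K T w) (l : ℕ) (k : K l) :
    passRate F l k = (∑ z, ((goodStrings F l k z).ncard / 2 ^ w l : ℝ)) / Fintype.card (X l) := by
  rw [passRate, Finset.sum_div]
  exact Finset.sum_congr rfl fun z _ => by rw [div_div]

theorem coherence_eq (F : NTCF X Y K T w) (l : ℕ) (k : K l) :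
    coherence F l k = (∑ z, clawOverlap F l k z * ((goodStrings F l k z).ncard / 2 ^ w l : ℝ))
      / Fintype.card (X l) := by
  rw [coherence, Finset.sum_div]
  exact Finset.sum_congr rfl fun z _ => by rw [← div_div, mul_div_assoc]

theorem card_bits (w : ℕ) : Nat.card (Bits w) = 2 ^ w := by
  simp [Nat.card_eq_fintype_card, ZMod.card]

theorem ncard_div_le_one {w : ℕ} (S : Set (Bits w)) : (S.ncard / 2 ^ w : ℝ) ≤ 1 := by
  rw [div_le_one (by positivity)]
  exact_mod_cast (Set.ncard_le_card S).trans_eq (card_bits w)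

theorem coherence_nonneg (F : NTCF X Y K T w) (l : ℕ) (k : K l) : 0 ≤ coherence F l k := by
  rw [coherence_eq]
  exact div_nonneg (Finset.sum_nonneg fun z _ =>
    mul_nonneg (clawOverlap_nonneg F l k z) (by positivity)) (Nat.cast_nonneg _)

theorem coherence_le_passRate (F : NTCF X Y K T w) (l : ℕ) (k : K l) :
    coherence F l k ≤ passRate F l k := by
  rw [coherence_eq, passRate_eq]
  refine div_le_div_of_nonneg_right (Finset.sum_le_sum fun z _ => ?_) (Nat.cast_nonneg _)
  exact mul_le_of_le_one_left (by positivity) (clawOverlap_le_one F l k z)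

theorem passRate_le_one (F : NTCF X Y K T w) (l : ℕ) (k : K l) : passRate F l k ≤ 1 := by
  rw [passRate_eq]
  refine div_le_one_of_le₀ ?_ (Nat.cast_nonneg _)
  simpa using Finset.sum_le_sum fun z (_ : z ∈ Finset.univ) =>
    ncard_div_le_one (goodStrings F l k z)

/-- Overlaps lie in `[0, 1]`, so `0 ≤ coherence ≤ passRate`. Nonnegativity is what permits dropping
the flipped terms. -/
theorem flipWeight_nonneg (F : NTCF X Y K T w) (l : ℕ) (k : K l) (s : Bit) :
    0 ≤ flipWeight F l k s := by
  have h1 := coherence_nonneg F l k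
  have h2 := coherence_le_passRate F l k
  rcases bit_eq_zero_or_one s with rfl | rfl <;>
    simp only [flipWeight, bitSign_zero, bitSign_one] <;> linarith

theorem flipWeight_zero_le_one (F : NTCF X Y K T w) (l : ℕ) (k : K l) :
    flipWeight F l k 0 ≤ 1 := by
  have h1 := passRate_le_one F l k
  have h2 := coherence_le_passRate F l k
  simp only [flipWeight, bitSign_zero]
  linarith

/-- Union bound on the complements. -/
theorem one_sub_le_ncard_inter {w : ℕ} (S S' : Set (Bits w)) {ε : ℝ}
    (hS : (Sᶜ.ncard : ℝ) / 2 ^ w ≤ ε) (hS' : (S'ᶜ.ncard : ℝ) / 2 ^ w ≤ ε) :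
    1 - 2 * ε ≤ ((S ∩ S').ncard : ℝ) / 2 ^ w := by
  have h1 := Set.ncard_add_ncard_compl (S ∩ S')
  rw [card_bits, Set.compl_inter] at h1
  have h2 := Set.ncard_union_le Sᶜ S'ᶜ
  have h3 : (2 : ℝ) ^ w ≤ (S ∩ S').ncard + (Sᶜ.ncard + S'ᶜ.ncard) := by
    exact_mod_cast (by omega : 2 ^ w ≤ (S ∩ S').ncard + (Sᶜ.ncard + S'ᶜ.ncard))
  have hp : (0 : ℝ) < 2 ^ w := by positivity
  rw [div_le_iff₀ hp] at hS hS'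
  rw [le_div_iff₀ hp]
  linarith

/-- The exact densities of a claw coincide, so its approximate ones are close by the weak triangle
inequality through that common density. The two Hellinger errors average to `2 * εH`, and the two
checks cost `2 * εG`. -/
theorem one_sub_le_flipWeight (F : NTCF X Y K T w) (l : ℕ) (kt : K l × T l)
    (hkt : kt ∈ (F.gen l).support) {εH εG : ℝ}
    (hH : ∀ b, (∑ x, hellingerSq (F.f l kt.1 b x) (F.fApprox l kt.1 b x)) / Fintype.card (X l) ≤ εH)
    (hG : ∀ b x, ((F.G l kt.1 b x)ᶜ.ncard : ℝ) / 2 ^ w l ≤ εG) :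
    1 - (2 * εG + 2 * εH) ≤ flipWeight F l kt.1 0 := by
  have hne := nonempty_of_pureState (F.samp l kt.1 0)
  have hN : (0 : ℝ) < Fintype.card (X l) := by exact_mod_cast Fintype.card_pos
  set h := fun b x => hellingerSq (F.f l kt.1 b x) (F.fApprox l kt.1 b x) with hh
  have hz : ∀ z, 1 - 2 * εG - (h 0 z + h 1 (F.matching l kt.1 z)) ≤
      ((goodStrings F l kt.1 z).ncard / 2 ^ w l +
        clawOverlap F l kt.1 z * ((goodStrings F l kt.1 z).ncard / 2 ^ w l)) / 2 := by
    intro z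
    have h1 : 1 - 2 * εG ≤ ((goodStrings F l kt.1 z).ncard / 2 ^ w l : ℝ) :=
      one_sub_le_ncard_inter _ _ (hG _ _) (hG _ _)
    have h2 := ncard_div_le_one (goodStrings F l kt.1 z)
    have h3 := clawOverlap_le_one F l kt.1 z
    have h4 : 1 - clawOverlap F l kt.1 z ≤ 2 * (h 0 z + h 1 (F.matching l kt.1 z)) := by
      have tri := hellingerSq_le_two_mul_add (F.fApprox l kt.1 0 z) (F.f l kt.1 0 z)
        (F.fApprox l kt.1 1 (F.matching l kt.1 z))
      have e0 : hellingerSq (F.fApprox l kt.1 0 z) (F.f l kt.1 0 z) = h 0 z :=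
        hellingerSq_comm _ _
      have e1 : hellingerSq (F.f l kt.1 0 z) (F.fApprox l kt.1 1 (F.matching l kt.1 z))
          = h 1 (F.matching l kt.1 z) := by
        rw [(F.injective_pair l kt hkt z (F.matching l kt.1 z)).2 rfl]
      rw [e0, e1] at tri
      rw [clawOverlap_eq]
      linarith
    -- With pass fraction `g` and overlap `o`, `(1 - g)(1 - o) ≥ 0` gives `(g + o g) / 2 ≥ g - (1 -
    -- o) / 2`.
    nlinarith [mul_nonneg (sub_nonneg.2 h2) (sub_nonneg.2 h3)]
  have hs := Finset.sum_le_sum fun z (_ : z ∈ Finset.univ) => hz z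
  -- The matching is a bijection, so the errors at the matched points sum to the errors over the
  -- whole domain.
  rw [Finset.sum_sub_distrib, Finset.sum_add_distrib, Equiv.sum_comp (F.matching l kt.1) (h 1),
    ← Finset.sum_div, Finset.sum_add_distrib] at hs
  have h0 := hH 0
  have h1 := hH 1
  rw [div_le_iff₀ hN] at h0 h1
  rw [flipWeight, bitSign_zero, passRate_eq, coherence_eq, one_mul, ← add_div, div_div,
    mul_comm (Fintype.card (X l) : ℝ), ← div_div, le_div_iff₀ hN]
  refine le_trans ?_ hs
  simp only [Finset.sum_const, Finset.card_univ, nsmul_eq_mul]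
  linarith

end Families

/-! ### Distributions that dominate a multiple of a given one -/

/-- The difference `C - D` is at least `-δ D`, so adding `2 δ D` to it bounds its absolute value. In
the sum over outcomes the differences cancel and `2 δ` remains. -/
theorem tvDist_le_of_le {β : Type} [Fintype β] (C D : PMF β) {δ : ℝ} (hδ : 0 ≤ δ)
    (h : ∀ m, (1 - δ) * (D m).toReal ≤ (C m).toReal) : tvDist C D ≤ δ := by
  have hm : ∀ m, |(C m).toReal - (D m).toReal|
      ≤ (C m).toReal - (D m).toReal + 2 * δ * (D m).toReal := by
    intro m
    have := h m
    have h2 : 0 ≤ δ * (D m).toReal := mul_nonneg hδ ENNReal.toReal_nonneg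
    rw [abs_le]
    constructor <;> linarith
  have hs := Finset.sum_le_sum fun m (_ : m ∈ Finset.univ) => hm m
  rw [Finset.sum_add_distrib, Finset.sum_sub_distrib, ← Finset.mul_sum, sum_toReal_eq_one,
    sum_toReal_eq_one] at hs
  rw [tvDist]
  linarith

theorem one_sub_le_map_fst_true {β : Type} [Fintype β] (Q : PMF (Bool × β)) (D : PMF β) {δ : ℝ}
    (h : ∀ m, (1 - δ) * (D m).toReal ≤ (Q (true, m)).toReal) :
    1 - δ ≤ (Q.map Prod.fst true).toReal := by
  classical
  have e : Q.map Prod.fst true = ∑ m, Q (true, m) := by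
    rw [PMF.map_apply, tsum_fintype, Fintype.sum_prod_type, Fintype.sum_bool]
    simp
  rw [e, ENNReal.toReal_sum fun m _ => Q.apply_ne_top _]
  have hs := Finset.sum_le_sum fun m (_ : m ∈ Finset.univ) => h m
  rwa [← Finset.mul_sum, sum_toReal_eq_one, mul_one] at hs

/-- Conditioning divides by the acceptance probability, which is at most one. -/
theorem le_map_snd_filter {β : Type} (Q : PMF (Bool × β))
    (hQ : ∃ v ∈ {v : Bool × β | v.1 = true}, v ∈ Q.support) (m : β) :
    Q (true, m) ≤ (Q.filter {v | v.1 = true} hQ).map Prod.snd m := by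
  classical
  rw [PMF.map_apply]
  refine le_trans ?_ (ENNReal.le_tsum (true, m))
  rw [if_pos rfl, PMF.filter_apply, Set.indicator_of_mem (by simp)]
  refine le_mul_of_one_le_right' (ENNReal.one_le_inv.2 ?_)
  rw [← Q.tsum_coe]
  exact ENNReal.tsum_le_tsum fun v => Set.indicator_le_self' (fun _ _ => zero_le) v

theorem one_sub_mul_le_prod {n : ℕ} (p : Fin n → ℝ) {ε : ℝ} (h0 : ∀ i, 0 ≤ p i)
    (h1 : ∀ i, p i ≤ 1) (h : ∀ i, 1 - ε ≤ p i) : 1 - n * ε ≤ ∏ i, p i := by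
  induction n with
  | zero => simp
  | succ n ih =>
    rw [Fin.prod_univ_succ]
    have i1 := ih (fun i => p i.succ) (fun i => h0 _) (fun i => h1 _) (fun i => h _)
    have i2 : ∏ i : Fin n, p i.succ ≤ 1 := Finset.prod_le_one (fun i _ => h0 _) (fun i _ => h1 _)
    push_cast
    nlinarith [mul_nonneg (sub_nonneg.2 (h1 0)) (sub_nonneg.2 i2), h 0]

/-! ### The honest prover -/

theorem QState.apply_apply {ι κ τ : Type} [Fintype ι] [DecidableEq ι] [Fintype κ] [DecidableEq κ]
    [Fintype τ] (ρ : QState ι) (A : LIso ι κ) (B : LIso κ τ) :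
    (ρ.apply A).apply B = ρ.apply (B.comp A) := by
  simp only [QState.apply, LIso.comp, Matrix.conjTranspose_mul, Matrix.mul_assoc]

theorem tensor_comp {ι κ τ : Type} [Fintype ι] [DecidableEq ι] [Fintype κ] [DecidableEq κ]
    [Fintype τ] {n : ℕ} (A : Fin n → LIso ι κ) (B : Fin n → LIso κ τ) :
    (LIso.tensor B).comp (LIso.tensor A) = LIso.tensor fun i => (B i).comp (A i) := by
  simp only [LIso.comp, LIso.tensor, LIso.mk.injEq]
  ext a b
  simp only [Matrix.mul_apply, Matrix.of_apply, ← Finset.prod_mul_distrib]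
  exact (Fintype.prod_sum fun i j => (B i).mat (a i) j * (A i).mat j (b i)).symm

theorem bornWeight_mul_mul_conjTranspose {ι κ : Type} [Fintype ι] [Fintype κ]
    (C : Matrix κ ι ℂ) (M : Matrix ι ι ℂ) (u : κ → ℂ) :
    bornWeight (C * M * Cᴴ) u = bornWeight M (u ᵥ* C) := by
  set U : Matrix Unit κ ℂ := Matrix.of fun _ => u with hU
  have h1 := mul_mul_conjTranspose_apply_self U (C * M * Cᴴ) ()
  have h2 := mul_mul_conjTranspose_apply_self (U * C) M ()
  rw [Matrix.conjTranspose_mul] at h2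
  simp only [Matrix.mul_assoc] at h1 h2
  rw [Matrix.mul_assoc]
  exact h1.symm.trans h2

section Committed

variable {X Y K : Type} [Fintype X] [Fintype Y] {n : ℕ}

/-- The part of the commitment to all qubits that belongs to the commitment strings `y`. -/
def commitBranches (samp : K → Bit → PureState (X × Y)) (k : Fin n → K) (y : Fin n → Y) :
    Matrix (Fin n → Bit × X) (Bits n) ℂ :=
  Matrix.of fun s b => ∏ i, commitBranch (samp (k i)) (y i) (s i) (b i)

theorem committedState_branch (samp : K → Bit → PureState (X × Y)) (ρ : QState (Bits n))
    (k : Fin n → K) (y : Fin n → Y) :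
    (committedState samp ρ k).branch y
      = commitBranches samp k y * ρ.mat * (commitBranches samp k y)ᴴ := rfl

/-- Operations and commitments act qubit by qubit, so the amplitude of a joint outcome factorises
even though `ρ` need not be a product state. -/
theorem bornWeight_committedState [DecidableEq X] {w : ℕ} (samp : K → Bit → PureState (X × Y))
    (J : X ↪ Bits w) (ρ : QState (Bits n)) (k : Fin n → K) (y : Fin n → Y)
    (a : Fin n → Bit × Bits w) :
    bornWeight ((committedState samp ρ k).branch y) ((LIso.tensor fun _ => hadamardStep J).mat a)
      = bornWeight ρ.mat fun b => ∏ i, answerAmp (samp (k i)) J (y i) (a i) (b i) := by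
  rw [committedState_branch, bornWeight_mul_mul_conjTranspose]
  congr 1
  funext b
  simp only [Matrix.vecMul, dotProduct, commitBranches, Matrix.of_apply, tensor_apply,
    ← Finset.prod_mul_distrib, answerAmp, Matrix.mul_apply]
  exact (Fintype.prod_sum fun i s => (hadamardStep J).mat (a i) s *
    commitBranch (samp (k i)) (y i) s (b i)).symm

/-- Outcomes of positive probability of the standard basis measurement of a committed state. -/
theorem vec_ne_zero_of_mem_support (samp : K → Bit → PureState (X × Y)) (ρ : QState (Bits n))
    (k : Fin n → K) {y : Fin n → Y} (hy : y ∈ (committedState samp ρ k).measureSnd.support)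
    {a : Fin n → Bit × X} (ha : a ∈ ((committedState samp ρ k).post y hy).measure.support)
    (i : Fin n) : (samp (k i) (a i).1).vec ((a i).2, y i) ≠ 0 := by
  intro h0
  refine (PMF.mem_support_iff _ _).1 ha ?_
  -- One vanishing factor annihilates the entire amplitude row of the outcome, whatever `ρ` is.
  have hC : commitBranches samp k y a = 0 := by
    funext b
    refine Finset.prod_eq_zero (Finset.mem_univ i) ?_
    simp only [commitBranch, Matrix.of_apply]
    split_ifs with hb
    · rw [← hb, h0]
    · rfl
  have hbr : (committedState samp ρ k).branch y a a = 0 := by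
    rw [committedState_branch, mul_mul_conjTranspose_apply_self, hC]
    simp [bornWeight]
  have hpost : ((committedState samp ρ k).post y hy).mat a a
      = (((committedState samp ρ k).branch y).trace.re⁻¹ : ℝ)
        • (committedState samp ρ k).branch y a a := rfl
  rw [QState.measure_apply, hpost, hbr]
  simp

end Committed

/-! ### Test round -/

section Rounds

variable {X Y K T : ℕ → Type} [∀ l, Fintype (X l)] [∀ l, Fintype (Y l)] {w : ℕ → ℕ}

theorem mem_support_verifierKeys (E : ExtendedTCF X Y K T w) (l : ℕ) {n : ℕ} {h : Bits n}
    {kt : Fin n → K l × T l} (hkt : kt ∈ (verifierKeys E l h).support) (i : Fin n) :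
    (h i = 0 ∧ kt i ∈ (E.I.gen l).support) ∨ (h i = 1 ∧ kt i ∈ (E.F.gen l).support) := by
  have := mem_support_independent hkt i
  rcases bit_eq_zero_or_one (h i) with hi | hi
  · exact Or.inl ⟨hi, by simpa [hi] using this⟩
  · exact Or.inr ⟨hi, by simpa [hi] using this⟩

theorem testAccept_honestProver [∀ l, DecidableEq (X l)]
    (E : ExtendedTCF X Y K T w) (l : ℕ) {n : ℕ} (ρ : QState (Bits n))
    (h : Bits n) : testAccept E l (honestProver (E.F.samp l) (E.F.J l) ρ) h = 1 := by
  set Q := testRound E l (honestProver (E.F.samp l) (E.F.J l) ρ) h with hQ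
  have hfalse : ∀ b ∈ Q.support, b = true := by
    intro b hb
    rw [hQ, testRound, PMF.mem_support_bind_iff] at hb
    obtain ⟨kt, hkt, hb⟩ := hb
    rw [PMF.mem_support_bind_iff] at hb
    obtain ⟨ys, hys, hb⟩ := hb
    rw [PMF.mem_support_bind_iff] at hb
    obtain ⟨a, ha, hb⟩ := hb
    rw [PMF.mem_support_pure_iff] at hb
    rw [hb, decide_eq_true_eq]
    obtain ⟨y, hy, hys⟩ := (PMF.mem_support_bindOnSupport_iff _ _).1 hys
    obtain rfl := (PMF.mem_support_pure_iff _ _).1 hys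
    intro i
    have hv := vec_ne_zero_of_mem_support (E.F.samp l) ρ (fun i => (kt i).1) hy ha i
    rcases mem_support_verifierKeys E l hkt i with ⟨hi, hk⟩ | ⟨hi, hk⟩
    · rw [testCheck, if_pos hi, E.I.chk_iff l _ hk, PMF.mem_support_iff]
      intro h0
      rw [E.samp_same, E.I.samp_eq l _ hk, h0] at hv
      simp at hv
    · rw [testCheck, if_neg (by simp [hi]), E.F.chk_iff l _ hk, PMF.mem_support_iff]
      intro h0
      rw [E.F.samp_eq l _ hk, h0] at hv
      simp at hv
  have h1 : Q true = 1 := by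
    rw [PMF.apply_eq_one_iff]
    obtain ⟨b, hb⟩ := Q.support_nonempty
    have := hfalse b hb
    subst this
    exact Set.eq_singleton_iff_unique_mem.2 ⟨hb, hfalse⟩
  rw [testAccept, ← hQ, h1, ENNReal.toReal_one]

/-! ### Hadamard round -/

theorem honestProver_hadamard_apply [∀ l, DecidableEq (X l)]
    (E : ExtendedTCF X Y K T w) (l : ℕ) {n : ℕ}
    (ρ : QState (Bits n)) (h m : Bits n) (kt : Fin n → K l × T l) :
    (((honestProver (E.F.samp l) (E.F.J l) ρ).commit fun i => (kt i).1).bind fun ys =>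
      ((honestProver (E.F.samp l) (E.F.J l) ρ).hadamardAnswer ys.2).bind fun a =>
        (independent fun i => decode E l (h i) (kt i).1 (kt i).2 (ys.1 i) (a i)).map fun v =>
          (decide (∀ i, (v i).1 = true), fun i => (v i).2)) (true, m)
      = ENNReal.ofReal (∑ r : Fin n → Y l × (Bit × Bits (w l)),
          (∏ i, (decode E l (h i) (kt i).1 (kt i).2 (r i).1 (r i).2 (true, m i)).toReal) *
            (bornWeight ρ.mat fun b => ∏ i,
              answerAmp (E.F.samp l (kt i).1) (E.F.J l) (r i).1 (r i).2 (b i)).re) := by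
  have e := QState.partialMeasure_bind_apply
    (committedState (E.F.samp l) ρ fun i => (kt i).1)
    (LIso.tensor fun _ => hadamardStep (E.F.J l))
    (fun (y : Fin n → Y l) (a : Fin n → Bit × Bits (w l)) =>
      (independent fun i => decode E l (h i) (kt i).1 (kt i).2 (y i) (a i)).map fun v =>
          (decide (∀ i, (v i).1 = true), fun i => (v i).2)) (true, m)
  simp only [honestProver, QState.apply_apply, tensor_comp]
  refine e.trans ?_
  simp only [independent_map_true_apply, bornWeight_committedState]
  -- Pairs of strings `(y, a)` are regrouped into one pair per qubit, which exposes the product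
  -- form.
  rw [ENNReal.ofReal_sum_of_nonneg fun r _ => mul_nonneg
    (Finset.prod_nonneg fun i _ => ENNReal.toReal_nonneg) (ρ.bornWeight_nonneg _),
    ← Equiv.sum_comp (Equiv.arrowProdEquivProdArrow (Fin n) (fun _ => Y l)
      (fun _ => Bit × Bits (w l))).symm, Fintype.sum_prod_type]
  refine Finset.sum_congr rfl fun y _ => Finset.sum_congr rfl fun a _ => ?_
  rw [ENNReal.ofReal_mul (Finset.prod_nonneg fun i _ => ENNReal.toReal_nonneg), mul_comm,
    ENNReal.ofReal_prod_of_nonneg fun i _ => ENNReal.toReal_nonneg]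
  congr 1
  refine Finset.prod_congr rfl fun i _ => ?_
  exact (ENNReal.ofReal_toReal (PMF.apply_ne_top _ _)).symm

theorem basisMeasure_apply {n : ℕ} (ρ : QState (Bits n)) (h m : Bits n) :
    basisMeasure ρ h m = ENNReal.ofReal (bornWeight ρ.mat fun b =>
      ∏ i, (if h i = 0 then LIso.id Bit else hadamard).mat (m i) (b i)).re := by
  rw [basisMeasure, QState.apply_measure]
  rfl

/-- The bound holds for every key tuple of positive probability, hence for the average over keys. -/
theorem le_hadamardRound_apply [∀ l, DecidableEq (X l)]
    (E : ExtendedTCF X Y K T w) (l : ℕ) {n : ℕ} (ρ : QState (Bits n))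
    (h m : Bits n) {ε : ℝ} (hε : 0 ≤ ε)
    (hflip : ∀ kt ∈ (E.F.gen l).support, 1 - ε ≤ flipWeight E.F l kt.1 0) :
    ENNReal.ofReal (1 - n * ε) * basisMeasure ρ h m
      ≤ hadamardRound E l (honestProver (E.F.samp l) (E.F.J l) ρ) h (true, m) := by
  rw [hadamardRound, PMF.bind_apply]
  calc _ = ∑' kt, verifierKeys E l h kt * (ENNReal.ofReal (1 - n * ε) * basisMeasure ρ h m) := by
        rw [ENNReal.tsum_mul_right, PMF.tsum_coe, one_mul]
    _ ≤ _ := ENNReal.tsum_le_tsum fun kt => ?_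
  by_cases hkt : kt ∈ (verifierKeys E l h).support
  swap
  · rw [PMF.mem_support_iff, not_not] at hkt
    rw [hkt, zero_mul, zero_mul]
  refine mul_le_mul_right ?_ _
  rw [honestProver_hadamard_apply]
  -- Injective keys never flip the result, so all their weight is on `s = 0`.
  set r : Fin n → Bit → ℝ := fun i s =>
    if h i = 0 then (if s = 0 then 1 else 0) else flipWeight E.F l (kt i).1 s with hr
  have hr0 : ∀ i s, 0 ≤ r i s := by
    intro i s
    simp only [hr]
    split_ifs
    · exact zero_le_one
    · exact le_rfl
    · exact flipWeight_nonneg _ _ _ _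
  have hr1 : ∀ i, r i 0 ≤ 1 := by
    intro i
    simp only [hr]
    split_ifs
    · exact le_rfl
    · exact flipWeight_zero_le_one _ _ _
  have hrε : ∀ i, 1 - ε ≤ r i 0 := by
    intro i
    simp only [hr]
    rcases mem_support_verifierKeys E l hkt i with ⟨hi, hk⟩ | ⟨hi, hk⟩
    · simp [hi, hε]
    · simpa [hi] using hflip _ hk
  have key := le_sum_prod_mul_bornWeight ρ
    (fun i (a : Y l × (Bit × Bits (w l))) =>
      (decode E l (h i) (kt i).1 (kt i).2 a.1 a.2 (true, m i)).toReal)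
    (fun i a b => answerAmp (E.F.samp l (kt i).1) (E.F.J l) a.1 a.2 b)
    (fun i => (if h i = 0 then LIso.id Bit else hadamard).mat) r hr0 m (by
      intro i b c
      rcases mem_support_verifierKeys E l hkt i with ⟨hi, hk⟩ | ⟨hi, hk⟩
      · simp only [hi, if_true, hr]
        rw [sum_decode_zero E l _ hk, sum_bit]
        simp
      · simp only [hi, hr, if_neg (one_ne_zero (α := Bit))]
        exact sum_decode_one E l _ hk (m i) b c)
  refine le_trans ?_ (ENNReal.ofReal_le_ofReal key)
  rw [ENNReal.ofReal_mul (Finset.prod_nonneg fun i _ => hr0 i 0), basisMeasure_apply]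
  exact mul_le_mul_left (ENNReal.ofReal_le_ofReal
    (one_sub_mul_le_prod _ (fun i => hr0 i 0) hr1 hrε)) _

end Rounds

/-! ### Negligible functions -/

theorem Negligible.mul_polyBounded {μ : ℕ → ℝ} (hμ : Negligible μ) {n : ℕ → ℕ}
    (hn : PolyBounded n) : Negligible fun l => n l * μ l := by
  obtain ⟨p, hp⟩ := hn
  refine ⟨fun l => mul_nonneg (Nat.cast_nonneg _) (hμ.1 l), ?_⟩
  refine (hμ.2.polynomial_mul p).trans_abs_le fun l => ?_
  rw [abs_mul, abs_mul]
  refine mul_le_mul_of_nonneg_right ?_ (abs_nonneg _)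
  rw [abs_of_nonneg (Nat.cast_nonneg _)]
  exact (hp l).trans (le_abs_self _)

theorem Negligible.two_mul_add {μ ν : ℕ → ℝ} (hμ : Negligible μ) (hν : Negligible ν) :
    Negligible fun l => 2 * μ l + 2 * ν l :=
  ⟨fun l => by linarith [hμ.1 l, hν.1 l], (hμ.2.const_mul 2).add (hν.2.const_mul 2)⟩

end

end MeasurementProtocol

open MeasurementProtocol
theorem mainTheorem7 {X Y K T : ℕ → Type} [∀ l, Fintype (X l)] [∀ l, DecidableEq (X l)]
    [∀ l, Fintype (Y l)] {w : ℕ → ℕ} (E : ExtendedTCF X Y K T w)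
    (n : ℕ → ℕ) (hn : PolyBounded n) :
    (∀ (l : ℕ) (ρ : QState (Bits (n l))) (h : Bits (n l)),
      testAccept E l (honestProver (E.F.samp l) (E.F.J l) ρ) h = 1) ∧
    ∃ μ : ℕ → ℝ, Negligible μ ∧
      ∀ (l : ℕ) (ρ : QState (Bits (n l))) (h : Bits (n l)),
        1 - μ l ≤ hadamardAccept E l (honestProver (E.F.samp l) (E.F.J l) ρ) h ∧
        ∀ hP : HadamardPossible E l (honestProver (E.F.samp l) (E.F.J l) ρ) h,
          tvDist (conditionedResults E l (honestProver (E.F.samp l) (E.F.J l) ρ) h hP)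
            (basisMeasure ρ h) ≤ μ l := by
  refine ⟨fun l ρ h => testAccept_honestProver E l ρ h, ?_⟩
  obtain ⟨μH, hμH, hH⟩ := E.F.hellinger_negligible
  obtain ⟨μG, hμG, hG⟩ := E.F.G_negligible
  have hε := hμG.two_mul_add hμH
  -- The witness is `n (2 μG + 2 μH)`: one error for each qubit, uniform in `ρ` and `h`.
  have hμ := hε.mul_polyBounded hn
  refine ⟨_, hμ, fun l ρ h => ?_⟩
  have hle : ∀ m, (1 - n l * (2 * μG l + 2 * μH l)) * (basisMeasure ρ h m).toReal
      ≤ (hadamardRound E l (honestProver (E.F.samp l) (E.F.J l) ρ) h (true, m)).toReal := by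
    intro m
    have := ENNReal.toReal_mono (PMF.apply_ne_top _ _)
      (le_hadamardRound_apply E l ρ h m (hε.1 l) fun kt hkt =>
        one_sub_le_flipWeight E.F l kt hkt (hH l kt hkt) (hG l kt hkt))
    -- The factor `1 - n ε` may be negative, so the conversion produces its maximum with `0`, which
    -- is still an upper bound for it.
    rw [ENNReal.toReal_mul, ENNReal.toReal_ofReal'] at this
    exact (mul_le_mul_of_nonneg_right (le_max_left _ _) ENNReal.toReal_nonneg).trans this
  refine ⟨one_sub_le_map_fst_true _ _ hle, fun hP => tvDist_le_of_le _ _ (hμ.1 l) fun m => ?_⟩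
  exact (hle m).trans (ENNReal.toReal_mono (PMF.apply_ne_top _ _) (le_map_snd_filter _ hP m))
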